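/- Let $k$ be a field of characteristic $0$, let $\ell\ge 0$, and let $B=\bigoplus_{\mathbf d\in\mathbf Z_{\ge0}^{\ell}}B_{\mathbf d}$ be a commutative $\mathbf Z_{\ge0}^{\ell}$-graded $k$-algebra which is generated as a $k$-algebra by the subspaces $B_{\mathbf d}$ with $|\mathbf d|=d_1+\dots+d_\ell=1$, each of these subspaces being finite-dimensional over $k$. For $\mathbf d\in\mathbf Z_{\ge0}^{\ell}$ and $m\ge0$ let $\mathcal I_B(1)_{\mathbf d,m}$ be the kernel of the multiplication map $\mathrm{Sym}^m(B_{\mathbf d})\to B_{m\mathbf d}$, and for $r\ge2$ define inductively $\mathcal I_B(r)_{\mathbf d,m}$ as the kernel of the map $$\mathrm{Sym}^m(B_{\mathbf d})\to\bigoplus_{i=0}^m \mathrm{Sym}^i(B_{\mathbf d})/\mathcal I_B(1)_{\mathbf d,i}\otimes_k \mathrm{Sym}^{m-i}(B_{\mathbf d})/\mathcal I_B(r-1)_{\mathbf d,m-i}$$ induced by the comultiplication of $\mathrm{Sym}(B_{\mathbf d})$ (the algebra homomorphism with $v\mapsto v\otimes1+1\otimes v$ for $v\in B_{\mathbf d}$).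 Then $\bigoplus_m\mathcal I_B(r)_{\mathbf d,m}$ is a homogeneous ideal of $\mathrm{Sym}(B_{\mathbf d})$; put $$\mathrm{Sec}_{\mathbf d,r}(B)=\bigoplus_{m\ge0}\mathrm{Sym}^m(B_{\mathbf d})/\mathcal I_B(r)_{\mathbf d,m},$$ a graded $\mathrm{Sym}(B_{\mathbf d})$-module. Theorem. There is a function $C_B(i,r)$, depending on $i$, $r$ and $B$ but not on $\mathbf d$, such that for all $i\ge0$, $r\ge1$ and $\mathbf d\in\mathbf Z_{\ge0}^{\ell}$ the graded vector space $\mathrm{Tor}_i^{\mathrm{Sym}(B_{\mathbf d})}(\mathrm{Sec}_{\mathbf d,r}(B),k)$ is concentrated in degrees $\le C_B(i,r)$. Here $k=\mathrm{Sym}(B_{\mathbf d})/\bigoplus_{m>0}\mathrm{Sym}^m(B_{\mathbf d})$, and $\mathrm{Tor}$ carries the grading induced by the grading of $\mathrm{Sym}(B_{\mathbf d})$ in which $\mathrm{Sym}^m(B_{\mathbf d})$ has degree $m$. -/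

import Mathlib

open scoped TensorProduct

noncomputable section

namespace SecantSyzygies

/-! ### Graded modules, graded projective resolutions and graded Tor -/

section GradedTor

universe u w

variable {k : Type u} {S : Type w} [CommRing k] [CommRing S] [Algebra k S]

/-- `ℳ` is a grading of the `S`-module `M`, where `S` is graded by `𝒮`:
`M = ⨁ₙ ℳ n` and `𝒮 a • ℳ b ⊆ ℳ (a + b)`. -/
structure IsGradedModule (𝒮 : ℕ → Submodule k S) {M : Type w} [AddCommGroup M] [Module S M]
    (ℳ : ℕ → AddSubgroup M) : Prop where
  internal : DirectSum.IsInternal ℳ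
  smul_mem : ∀ {a b : ℕ} {s : S} {x : M}, s ∈ 𝒮 a → x ∈ ℳ b → s • x ∈ ℳ (a + b)

/-- A projective resolution `⋯ → F 1 → F 0 → M → 0` of the graded `S`-module `M` by graded
`S`-modules, all maps being `S`-linear and homogeneous of degree zero. -/
structure GradedProjectiveResolution (𝒮 : ℕ → Submodule k S) (M : Type w) [AddCommGroup M]
    [Module S M] (ℳ : ℕ → AddSubgroup M) where
  F : ℕ → Type w
  [addCommGroup : ∀ i, AddCommGroup (F i)]
  [module : ∀ i, Module S (F i)]
  gr : ∀ i, ℕ → AddSubgroup (F i)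
  isGraded : ∀ i, IsGradedModule 𝒮 (gr i)
  projective : ∀ i, Module.Projective S (F i)
  d : ∀ i, F (i + 1) →ₗ[S] F i
  ε : F 0 →ₗ[S] M
  d_mem : ∀ i j, ∀ x ∈ gr (i + 1) j, d i x ∈ gr i j
  ε_mem : ∀ j, ∀ x ∈ gr 0 j, ε x ∈ ℳ j
  exact_d : ∀ i, Function.Exact (d (i + 1)) (d i)
  exact_ε : Function.Exact (d 0) ε
  surjective_ε : Function.Surjective ε

attribute [instance] GradedProjectiveResolution.addCommGroup GradedProjectiveResolution.module

namespace GradedProjectiveResolution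

variable {𝒮 : ℕ → Submodule k S} {M : Type w} [AddCommGroup M] [Module S M]
  {ℳ : ℕ → AddSubgroup M} (P : GradedProjectiveResolution 𝒮 M ℳ) (𝔪 : Ideal S)

/-- The `i`-cycles of the complex `F ⊗_S (S ⧸ 𝔪)`. -/
def cycles : ∀ i : ℕ, Submodule S (P.F i ⊗[S] (S ⧸ 𝔪))
  | 0 => ⊤
  | i + 1 => LinearMap.ker ((P.d i).rTensor (S ⧸ 𝔪))

/-- The `i`-boundaries of the complex `F ⊗_S (S ⧸ 𝔪)`. -/
def boundaries (i : ℕ) : Submodule S (P.F i ⊗[S] (S ⧸ 𝔪)) :=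
  LinearMap.range ((P.d i).rTensor (S ⧸ 𝔪))

/-- `Tor_i^S(M, S ⧸ 𝔪)`, the `i`-th homology of `F ⊗_S (S ⧸ 𝔪)`. -/
abbrev Tor (i : ℕ) : Type w :=
  P.cycles 𝔪 i ⧸ (P.boundaries 𝔪 i).submoduleOf (P.cycles 𝔪 i)

/-- The degree `j` part of `F i ⊗_S (S ⧸ 𝔪)`, where `𝔪` is the ideal of elements of positive
degree and so `S ⧸ 𝔪` sits in degree zero: it consists of all `x ⊗ 1` with `x` of degree `j`. -/
def tensorDeg (i j : ℕ) : AddSubgroup (P.F i ⊗[S] (S ⧸ 𝔪)) :=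
  (P.gr i j).map ((TensorProduct.mk S (P.F i) (S ⧸ 𝔪)).flip 1).toAddMonoidHom

/-- The degree `j` part of `Tor_i^S(M, S ⧸ 𝔪)`: the classes of the `i`-cycles of degree `j`. -/
def torDeg (i j : ℕ) : AddSubgroup (P.Tor 𝔪 i) :=
  ((P.tensorDeg 𝔪 i j).comap (P.cycles 𝔪 i).subtype.toAddMonoidHom).map
    ((P.boundaries 𝔪 i).submoduleOf (P.cycles 𝔪 i)).mkQ.toAddMonoidHom

end GradedProjectiveResolution

end GradedTor

/-! ### The symmetric algebra -/

section Sym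

universe u v

variable (k : Type u) [Field k] (V : Type v) [AddCommGroup V] [Module k V]

/-- `Sym^n(V)` as a subspace of `Sym(V)`. -/
def symGrading (n : ℕ) : Submodule k (SymmetricAlgebra k V) :=
  (LinearMap.range (SymmetricAlgebra.ι k V)) ^ n

/-- The ideal `⨁_{n > 0} Sym^n(V)` of `Sym(V)`, the kernel of `Sym(V) → k`. -/
def augIdeal : Ideal (SymmetricAlgebra k V) :=
  RingHom.ker (SymmetricAlgebra.algebraMapInv : SymmetricAlgebra k V →ₐ[k] k)

variable {k V}

/-- The comultiplication `Sym(V) → Sym(V) ⊗ Sym(V)`, `v ↦ v ⊗ 1 + 1 ⊗ v`, followed by the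
projection to `Sym(V) ⧸ I ⊗ Sym(V) ⧸ J`. It is homogeneous: in degree `m` it is the map
`Sym^m(V) → ⨁ᵢ Sym^i(V) ⧸ I_i ⊗ Sym^{m-i}(V) ⧸ J_{m-i}` if `I` and `J` are homogeneous. -/
def comulQuot (I J : Ideal (SymmetricAlgebra k V)) :
    SymmetricAlgebra k V →ₐ[k] (SymmetricAlgebra k V ⧸ I) ⊗[k] (SymmetricAlgebra k V ⧸ J) :=
  (Algebra.TensorProduct.map (Ideal.Quotient.mkₐ k I) (Ideal.Quotient.mkₐ k J)).comp
    (Bialgebra.comulAlgHom k (SymmetricAlgebra k V))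

/-- The family of subspaces of `Sym(V) ⧸ I` given by the images of the `Sym^m(V)`. It is a grading
if `I` is homogeneous. -/
def quotGrading (I : Ideal (SymmetricAlgebra k V)) (m : ℕ) :
    AddSubgroup (SymmetricAlgebra k V ⧸ I) :=
  ((symGrading k V m).map (Ideal.Quotient.mkₐ k I).toLinearMap).toAddSubgroup

end Sym

/-! ### Secant ideals -/

section Secant

universe u v

variable {k : Type u} [Field k] {B : Type v} [CommRing B] [Algebra k B] {ℓ : ℕ}

/-- The multiplication maps `Sym^m(B_d) → B_{md}` for all `m` at once: the homomorphism
`Sym(B_d) → B[T]` which sends `b₁ ⋯ b_m ∈ Sym^m(B_d)` to `(b₁ ⋯ b_m) T^m`. The variable `T` keeps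
the degrees `m` apart, which matters only for `d = 0`. -/
def mulMap (𝓑 : (Fin ℓ → ℕ) → Submodule k B) (d : Fin ℓ → ℕ) :
    SymmetricAlgebra k (𝓑 d) →ₐ[k] Polynomial B :=
  SymmetricAlgebra.lift
    (((Polynomial.monomial 1 : B →ₗ[B] Polynomial B).restrictScalars k) ∘ₗ (𝓑 d).subtype)

/-- `⨁_m I_B(r)_{d,m}` as an ideal of `Sym(B_d)`: the kernel of the multiplication maps for
`r = 1`, then inductively the kernel of the comultiplication to `Sym/I(1) ⊗ Sym/I(r-1)`.
(The value at `r = 0` is a convention; it is not used in what follows.) -/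
def secantIdeal (𝓑 : (Fin ℓ → ℕ) → Submodule k B) (d : Fin ℓ → ℕ) :
    ℕ → Ideal (SymmetricAlgebra k (𝓑 d))
  | 0 => augIdeal k (𝓑 d)
  | 1 => RingHom.ker (mulMap 𝓑 d)
  | r + 2 => RingHom.ker (comulQuot (RingHom.ker (mulMap 𝓑 d)) (secantIdeal 𝓑 d (r + 1)))

/-- `Sec_{d,r}(B) = ⨁_m Sym^m(B_d) ⧸ I_B(r)_{d,m}`. -/
abbrev Sec (𝓑 : (Fin ℓ → ℕ) → Submodule k B) (d : Fin ℓ → ℕ) (r : ℕ) : Type (max u v) :=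
  SymmetricAlgebra k (𝓑 d) ⧸ secantIdeal 𝓑 d r

/-- The graded projective resolutions over `Sym(B_d)` of `Sec_{d,r}(B)`. -/
abbrev SecResolution (𝓑 : (Fin ℓ → ℕ) → Submodule k B) (d : Fin ℓ → ℕ) (r : ℕ) :=
  GradedProjectiveResolution (symGrading k (𝓑 d)) (Sec 𝓑 d r) (quotGrading (secantIdeal 𝓑 d r))

/-- `Tor_i^{Sym(B_d)}(Sec_{d,r}(B), k)` is concentrated in degrees `≤ c`, where Tor is computed by
any graded projective resolution of `Sec_{d,r}(B)` (one exists, by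
`nonempty_secResolution` below), and `k = Sym(B_d) ⧸ ⨁_{n>0} Sym^n(B_d)`. -/
def TorSecConcentrated (𝓑 : (Fin ℓ → ℕ) → Submodule k B) (d : Fin ℓ → ℕ) (i r c : ℕ) : Prop :=
  ∀ P : SecResolution 𝓑 d r, ∀ j : ℕ, c < j → P.torDeg (augIdeal k (𝓑 d)) i j = ⊥

end Secant

/-! ### Existence of the resolutions

The `Sym^n(V)` grade `Sym(V)`, the secant ideals are homogeneous, and every graded module has a
graded projective resolution. Hence `nonempty_secResolution`: the quantifier over resolutions in
`TorSecConcentrated` is never empty. -/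

section GradedTor
universe u w
variable {k : Type u} {S : Type w} [CommRing k] [CommRing S] [Algebra k S]

/-- Homogeneous-component maps for a family of subgroups. -/
structure ProjSystem {M : Type*} [AddCommGroup M] (ℳ : ℕ → AddSubgroup M) where
  p : ℕ → M →+ M
  mem : ∀ j x, p j x ∈ ℳ j
  same : ∀ j, ∀ x ∈ ℳ j, p j x = x
  ne : ∀ i j, i ≠ j → ∀ x ∈ ℳ i, p j x = 0
  sum : ∀ x, ∃ s : Finset ℕ, ∑ j ∈ s, p j x = x

theorem ProjSystem.isInternal {M : Type*} [AddCommGroup M] {ℳ : ℕ → AddSubgroup M}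
    (P : ProjSystem ℳ) : DirectSum.IsInternal ℳ := by
  classical
  constructor
  · rw [injective_iff_map_eq_zero]
    have key : ∀ j x, P.p j (DirectSum.coeAddMonoidHom ℳ x) = x j := by
      intro j x
      induction x using DirectSum.induction_on with
      | zero => simp
      | of i y =>
        rw [DirectSum.coeAddMonoidHom_of]
        by_cases h : i = j
        · subst h; rw [P.same i _ y.2, DirectSum.of_eq_same]
        · rw [P.ne i j h _ y.2, DirectSum.of_eq_of_ne _ _ _ (Ne.symm h)]; rfl
      | add a b ha hb => simp [ha, hb]
    intro x hx
    ext j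
    rw [← key j x, hx]; simp
  · intro x
    obtain ⟨s, hs⟩ := P.sum x
    refine ⟨∑ j ∈ s, DirectSum.of (fun j => ℳ j) j ⟨P.p j x, P.mem j x⟩, ?_⟩
    rw [map_sum]
    simpa [DirectSum.coeAddMonoidHom_of] using hs

theorem ProjSystem.nonempty_of_isInternal {M : Type*} [AddCommGroup M] {ℳ : ℕ → AddSubgroup M}
    (h : DirectSum.IsInternal ℳ) : Nonempty (ProjSystem ℳ) := by
  classical
  let _ := h.chooseDecomposition
  exact ⟨{
    p := fun j => 
      { toFun := fun x => (DirectSum.decompose ℳ x j : M)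
        map_zero' := by simp
        map_add' := by simp }
    mem := fun j x => SetLike.coe_mem _
    same := fun j x hx => DirectSum.decompose_of_mem_same ℳ hx
    ne := fun i j hij x hx => DirectSum.decompose_of_mem_ne ℳ hx hij
    sum := fun x => ⟨_, DirectSum.sum_support_decompose ℳ x⟩ }⟩

section cover
variable {𝒮 : ℕ → Submodule k S} {M : Type w} [AddCommGroup M] [Module S M]
  (ℳ : ℕ → AddSubgroup M)

/-- Free module on homogeneous elements. -/
abbrev Cover : Type w := (Σ n, ℳ n) →₀ S

/-- The degree `j` part of the free cover. -/
def coverGr (𝒮 : ℕ → Submodule k S) (j : ℕ) : AddSubgroup (Cover (S := S) ℳ) where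
  carrier := {f | ∀ i, (i.1 ≤ j → f i ∈ 𝒮 (j - i.1)) ∧ (¬ i.1 ≤ j → f i = 0)}
  zero_mem' := by simp
  add_mem' := fun ha hb i => ⟨fun h => add_mem ((ha i).1 h) ((hb i).1 h),
    fun h => by simp [(ha i).2 h, (hb i).2 h]⟩
  neg_mem' := fun ha i => ⟨fun h => neg_mem ((ha i).1 h), fun h => by simp [(ha i).2 h]⟩

/-- The homogeneous components of elements of the free cover. -/
def coverProj (Q : ProjSystem fun n => (𝒮 n).toAddSubgroup) : ProjSystem (coverGr ℳ 𝒮) where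
  p j :=
    { toFun := fun f => Finsupp.onFinset f.support
        (fun i => if i.1 ≤ j then Q.p (j - i.1) (f i) else 0)
        (by intro i hi; simp only [Finsupp.mem_support_iff]; intro h; simp [h] at hi)
      map_zero' := by ext; simp
      map_add' := by intro f g; ext i; simp; split_ifs <;> simp }
  mem j f i := ⟨fun h => by simpa [h] using Q.mem (j - i.1) (f i), fun h => by simp [h]⟩
  same j f hf := by
    ext i
    by_cases h : i.1 ≤ j
    · simpa [h] using Q.same _ _ ((hf i).1 h)
    · simp [h, (hf i).2 h]
  ne a b hab f hf := by
    ext i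
    by_cases h : i.1 ≤ b
    · by_cases h' : i.1 ≤ a
      · simpa [h] using Q.ne (a - i.1) (b - i.1) (by omega) _ ((hf i).1 h')
      · simp [(hf i).2 h']
    · simp [h]
  sum f := by
    classical
    choose s hs using fun x => Q.sum x
    have hne : ∀ (x : S) (j : ℕ), j ∉ s x → Q.p j x = 0 := by
      intro x j hj
      have := congrArg (Q.p j) (hs x)
      rw [map_sum, Finset.sum_eq_zero] at this
      · exact this.symm
      · intro a ha
        exact Q.ne a j (by rintro rfl; exact hj ha) _ (Q.mem a x)
    refine ⟨f.support.biUnion fun i => (s (f i)).image (· + i.1), ?_⟩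
    ext i
    rw [Finsupp.finsetSum_apply]
    by_cases hi : f i = 0
    · simp [hi]
    · rw [← Finset.sum_subset (s₁ := (s (f i)).image (· + i.1))]
      · rw [Finset.sum_image (by intro a _ b _ h; simpa using h)]
        simpa using hs (f i)
      · intro a ha
        exact Finset.mem_biUnion.2 ⟨i, by simpa using hi, ha⟩
      · intro a _ ha
        simp only [AddMonoidHom.coe_mk, ZeroHom.coe_mk, Finsupp.onFinset_apply]
        split_ifs with h
        · refine hne _ _ fun h' => ha (Finset.mem_image.2 ⟨_, h', by omega⟩)
        · rfl

theorem isGraded_cover (h𝒮 : DirectSum.IsInternal fun n => (𝒮 n).toAddSubgroup)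
    (hmul : ∀ a b : ℕ, ∀ s ∈ 𝒮 a, ∀ t ∈ 𝒮 b, s * t ∈ 𝒮 (a + b)) :
    IsGradedModule 𝒮 (coverGr ℳ 𝒮) where
  internal := by
    obtain ⟨Q⟩ := ProjSystem.nonempty_of_isInternal h𝒮
    exact (coverProj ℳ Q).isInternal
  smul_mem := by
    intro a b s f hs hf i
    refine ⟨fun h => ?_, fun h => ?_⟩
    · by_cases h' : i.1 ≤ b
      · have := hmul a (b - i.1) s hs (f i) ((hf i).1 h')
        rw [show a + b - i.1 = a + (b - i.1) by omega]
        simpa using this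
      · simp [(hf i).2 h']
    · simp [(hf i).2 (by omega)]

/-- The cover map. -/
def coverMap : Cover (S := S) ℳ →ₗ[S] M := Finsupp.linearCombination S fun i => (i.2 : M)

theorem coverMap_mem (hM : IsGradedModule 𝒮 ℳ) (j : ℕ) (f) (hf : f ∈ coverGr ℳ 𝒮 j) :
    coverMap (S := S) ℳ f ∈ ℳ j := by
  rw [coverMap, Finsupp.linearCombination_apply]
  refine AddSubgroup.sum_mem _ fun i hi => ?_
  by_cases h : i.1 ≤ j
  · have := hM.smul_mem ((hf i).1 h) i.2.2
    rwa [Nat.sub_add_cancel h] at this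
  · simp [(hf i).2 h]

theorem coverMap_surjective (hM : IsGradedModule 𝒮 ℳ) :
    Function.Surjective (coverMap (S := S) ℳ) := by
  intro x
  obtain ⟨Q⟩ := ProjSystem.nonempty_of_isInternal hM.internal
  obtain ⟨s, hs⟩ := Q.sum x
  refine ⟨∑ j ∈ s, Finsupp.single ⟨j, Q.p j x, Q.mem j x⟩ 1, ?_⟩
  simpa [coverMap] using hs

theorem isGraded_ker {N : Type w} [AddCommGroup N] [Module S N] {𝒩 : ℕ → AddSubgroup N}
    (hM : IsGradedModule 𝒮 ℳ) (hN : IsGradedModule 𝒮 𝒩) (f : M →ₗ[S] N)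
    (hf : ∀ j, ∀ x ∈ ℳ j, f x ∈ 𝒩 j) :
    IsGradedModule 𝒮 (fun j => (ℳ j).comap (LinearMap.ker f).subtype.toAddMonoidHom) where
  internal := by
    obtain ⟨P⟩ := ProjSystem.nonempty_of_isInternal hM.internal
    obtain ⟨Q⟩ := ProjSystem.nonempty_of_isInternal hN.internal
    have hcomm : ∀ j x, f (P.p j x) = Q.p j (f x) := by
      intro j x
      obtain ⟨s, hs⟩ := P.sum x
      have hone : ∀ i, ∀ y ∈ ℳ i, f (P.p j y) = Q.p j (f y) := by
        intro i y hy
        by_cases hij : i = j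
        · subst hij; rw [P.same _ _ hy, Q.same _ _ (hf _ _ hy)]
        · rw [P.ne _ _ hij _ hy, Q.ne _ _ hij _ (hf _ _ hy), map_zero]
      rw [← hs]
      simp only [map_sum]
      exact Finset.sum_congr rfl fun i _ => hone i _ (P.mem i x)
    refine ProjSystem.isInternal ⟨fun j =>
      { toFun := fun x => ⟨P.p j x, by
          rw [LinearMap.mem_ker, hcomm, LinearMap.mem_ker.1 x.2, map_zero]⟩
        map_zero' := by ext; simp
        map_add' := by intro x y; ext; simp }, ?_, ?_, ?_, ?_⟩
    · intro j x; exact P.mem j x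
    · intro j x hx; ext; exact P.same j _ hx
    · intro i j hij x hx; ext; exact P.ne i j hij _ hx
    · intro x
      obtain ⟨s, hs⟩ := P.sum x
      exact ⟨s, by ext; simpa using hs⟩
  smul_mem := by
    intro a b s x hs hx
    exact hM.smul_mem hs hx

end cover

/-- Bundled graded modules. -/
structure GrMod (𝒮 : ℕ → Submodule k S) where
  M : Type w
  [acg : AddCommGroup M]
  [mod : Module S M]
  gr : ℕ → AddSubgroup M
  isGraded : IsGradedModule 𝒮 gr

attribute [instance] GrMod.acg GrMod.mod

variable {𝒮 : ℕ → Submodule k S}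

/-- Kernel of the free cover. -/
def GrMod.syz (h𝒮 : DirectSum.IsInternal fun n => (𝒮 n).toAddSubgroup)
    (hmul : ∀ a b : ℕ, ∀ s ∈ 𝒮 a, ∀ t ∈ 𝒮 b, s * t ∈ 𝒮 (a + b)) (G : GrMod 𝒮) : GrMod 𝒮 where
  M := LinearMap.ker (coverMap (S := S) G.gr)
  gr := fun j => (coverGr G.gr 𝒮 j).comap
    (LinearMap.ker (coverMap (S := S) G.gr)).subtype.toAddMonoidHom
  isGraded := isGraded_ker _ (isGraded_cover _ h𝒮 hmul) G.isGraded _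
    fun j f hf => coverMap_mem _ G.isGraded j f hf

/-- Iterated kernels of free covers. -/
def GrMod.syzIter (h𝒮 : DirectSum.IsInternal fun n => (𝒮 n).toAddSubgroup)
    (hmul : ∀ a b : ℕ, ∀ s ∈ 𝒮 a, ∀ t ∈ 𝒮 b, s * t ∈ 𝒮 (a + b)) (H : GrMod 𝒮) : ℕ → GrMod 𝒮
  | 0 => H
  | i + 1 => (H.syzIter h𝒮 hmul i).syz h𝒮 hmul

theorem nonempty_gradedProjectiveResolution
    (h𝒮 : DirectSum.IsInternal fun n => (𝒮 n).toAddSubgroup)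
    (hmul : ∀ a b : ℕ, ∀ s ∈ 𝒮 a, ∀ t ∈ 𝒮 b, s * t ∈ 𝒮 (a + b))
    {M : Type w} [AddCommGroup M] [Module S M] {ℳ : ℕ → AddSubgroup M}
    (hM : IsGradedModule 𝒮 ℳ) : Nonempty (GradedProjectiveResolution 𝒮 M ℳ) := by
  let H : GrMod 𝒮 := ⟨M, ℳ, hM⟩
  let G : ℕ → GrMod 𝒮 := H.syzIter h𝒮 hmul
  have hsurj : ∀ i, Function.Surjective (coverMap (S := S) (G i).gr) :=
    fun i => coverMap_surjective _ (G i).isGraded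
  exact ⟨{
    F := fun i => Cover (S := S) (G i).gr
    gr := fun i => coverGr (G i).gr 𝒮
    isGraded := fun i => isGraded_cover _ h𝒮 hmul
    projective := fun i => inferInstance
    d := fun i => (LinearMap.ker (coverMap (S := S) (G i).gr)).subtype ∘ₗ
      (coverMap (S := S) (G (i + 1)).gr)
    ε := coverMap (S := S) (G 0).gr
    d_mem := fun i j x hx => coverMap_mem (G (i + 1)).gr (G (i + 1)).isGraded j x hx
    ε_mem := fun j x hx => coverMap_mem (G 0).gr (G 0).isGraded j x hx
    exact_d := fun i x => by
      constructor
      · intro h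
        have h' : coverMap (S := S) (G (i + 1)).gr x = 0 := Subtype.ext h
        obtain ⟨y, hy⟩ := hsurj (i + 2) (⟨x, h'⟩ : LinearMap.ker (coverMap (S := S) (G (i + 1)).gr))
        exact ⟨y, congrArg Subtype.val hy⟩
      · rintro ⟨y, rfl⟩
        have h' : coverMap (S := S) (G (i + 1)).gr
          (coverMap (S := S) (G (i + 2)).gr y).1 = 0 := (coverMap (S := S) (G (i + 2)).gr y).2
        exact congrArg Subtype.val h'
    exact_ε := fun x => by
      constructor
      · intro h
        obtain ⟨y, hy⟩ := hsurj 1 (⟨x, h⟩ : LinearMap.ker (coverMap (S := S) (G 0).gr))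
        exact ⟨y, congrArg Subtype.val hy⟩
      · rintro ⟨y, rfl⟩
        exact (coverMap (S := S) (G 1).gr y).2
    surjective_ε := hsurj 0 }⟩

end GradedTor

section Sym
universe u v
open Polynomial
variable {k : Type u} [Field k] {V : Type v} [AddCommGroup V] [Module k V]

variable (k V) in
/-- The homomorphism `Sym(V) → Sym(V)[X]` which sends `x` in `Sym^n(V)` to `x X^n`. -/
def coact : SymmetricAlgebra k V →ₐ[k] (SymmetricAlgebra k V)[X] :=
  SymmetricAlgebra.lift (((monomial 1 : SymmetricAlgebra k V →ₗ[SymmetricAlgebra k V]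
    (SymmetricAlgebra k V)[X]).restrictScalars k) ∘ₗ SymmetricAlgebra.ι k V)

theorem coact_ι (v : V) : coact k V (SymmetricAlgebra.ι k V v) =
    monomial 1 (SymmetricAlgebra.ι k V v) := by
  simp [coact]

theorem coact_of_mem (n : ℕ) (x : SymmetricAlgebra k V) (hx : x ∈ symGrading k V n) :
    coact k V x = monomial n x := by
  unfold symGrading at hx
  induction hx using Submodule.pow_induction_on_left' with
  | algebraMap r => simp [Polynomial.algebraMap_apply]
  | add x y i hx hy h1 h2 => simp [h1, h2]
  | mem_mul m hm i x hx h =>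
    obtain ⟨v, rfl⟩ := hm
    rw [map_mul, h, coact_ι, monomial_mul_monomial, add_comm]

theorem symGrading_mul (a b : ℕ) (s : SymmetricAlgebra k V) (hs : s ∈ symGrading k V a)
    (t : SymmetricAlgebra k V) (ht : t ∈ symGrading k V b) : s * t ∈ symGrading k V (a + b) := by
  unfold symGrading at *
  rw [pow_add]
  exact Submodule.mul_mem_mul hs ht

theorem coeff_coact_mem (x : SymmetricAlgebra k V) (n : ℕ) :
    (coact k V x).coeff n ∈ symGrading k V n := by
  induction x using SymmetricAlgebra.induction generalizing n with
  | algebraMap r =>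
    rw [AlgHom.commutes, Polynomial.algebraMap_apply, coeff_C]
    split_ifs with h
    · subst h
      simp [symGrading, Submodule.mem_one]
    · exact zero_mem _
  | ι v =>
    rw [coact_ι, coeff_monomial]
    split_ifs with h
    · subst h
      simp [symGrading]
    · exact zero_mem _
  | mul a b ha hb =>
    rw [map_mul, coeff_mul]
    refine Submodule.sum_mem _ fun p hp => ?_
    rw [← Finset.HasAntidiagonal.mem_antidiagonal.1 hp]
    exact symGrading_mul _ _ _ (ha _) _ (hb _)
  | add a b ha hb =>
    rw [map_add, coeff_add]
    exact add_mem (ha _) (hb _)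

theorem eval_coact (x : SymmetricAlgebra k V) : (coact k V x).eval 1 = x := by
  have h : ((aeval (R := SymmetricAlgebra k V) (1 : SymmetricAlgebra k V)).restrictScalars k).comp
      (coact k V) = AlgHom.id k _ := by
    ext v
    simp [coact_ι]
  have := congrArg (fun f => f x) h
  simpa [aeval_def, eval₂_eq_eval_map] using this

theorem sum_coeff_coact (x : SymmetricAlgebra k V) :
    ∑ j ∈ (coact k V x).support, (coact k V x).coeff j = x := by
  have := eval_coact x
  rw [eval_eq_sum, Polynomial.sum] at this
  simpa using this

theorem isInternal_symGrading :
    DirectSum.IsInternal fun n => (symGrading k V n).toAddSubgroup := by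
  refine ProjSystem.isInternal ⟨fun j =>
    ((lcoeff (SymmetricAlgebra k V) j).toAddMonoidHom).comp (coact k V : _ →+ _), ?_, ?_, ?_, ?_⟩
  · intro j x; exact coeff_coact_mem x j
  · intro j x hx
    simp [coact_of_mem j x hx]
  · intro i j hij x hx
    simp [coact_of_mem i x hx, coeff_monomial, hij]
  · intro x
    exact ⟨_, sum_coeff_coact x⟩

/-- An ideal of `Sym(V)` is homogeneous if it contains the components of its elements. -/
def IsHomog (I : Ideal (SymmetricAlgebra k V)) : Prop :=
  ∀ x ∈ I, ∀ j, (coact k V x).coeff j ∈ I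

theorem isHomog_ker {A : Type*} [Semiring A] [Algebra k A] (f : SymmetricAlgebra k V →ₐ[k] A)
    (σ : A →ₐ[k] A[X]) (h : ∀ v, σ (f (SymmetricAlgebra.ι k V v)) =
      monomial 1 (f (SymmetricAlgebra.ι k V v))) : IsHomog (RingHom.ker f) := by
  have hc : ∀ x, σ (f x) = mapAlgHom f (coact k V x) := by
    intro x
    induction x using SymmetricAlgebra.induction with
    | algebraMap r => simp only [AlgHom.commutes]
    | ι v => rw [h, coact_ι]; simp
    | mul a b ha hb => simp only [map_mul, ha, hb]
    | add a b ha hb => simp only [map_add, ha, hb]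
  intro x hx j
  have := congrArg (fun g => g.coeff j) (hc x)
  rw [RingHom.mem_ker] at hx ⊢
  simpa [hx] using this.symm

/-- The coaction on a quotient by a homogeneous ideal. -/
def quotCoact (I : Ideal (SymmetricAlgebra k V)) (hI : IsHomog I) :
    (SymmetricAlgebra k V ⧸ I) →ₐ[k] (SymmetricAlgebra k V ⧸ I)[X] :=
  Ideal.Quotient.liftₐ I ((mapAlgHom (Ideal.Quotient.mkₐ k I)).comp (coact k V)) (by
    intro x hx
    ext j
    simpa [Ideal.Quotient.eq_zero_iff_mem] using hI x hx j)

theorem quotCoact_mk (I : Ideal (SymmetricAlgebra k V)) (hI : IsHomog I)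
    (x : SymmetricAlgebra k V) : quotCoact I hI (Ideal.Quotient.mk I x) =
      (coact k V x).map (Ideal.Quotient.mk I) := by
  rfl

/-- The coaction on a tensor product. -/
def tensorCoact {A C : Type*} [CommRing A] [CommRing C] [Algebra k A] [Algebra k C]
    (α : A →ₐ[k] A[X]) (β : C →ₐ[k] C[X]) : A ⊗[k] C →ₐ[k] (A ⊗[k] C)[X] :=
  Algebra.TensorProduct.lift
    ((mapAlgHom Algebra.TensorProduct.includeLeft).comp α)
    ((mapAlgHom Algebra.TensorProduct.includeRight).comp β)
    (fun _ _ => mul_comm _ _)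

theorem tensorCoact_add {A C : Type*} [CommRing A] [CommRing C] [Algebra k A] [Algebra k C]
    (α : A →ₐ[k] A[X]) (β : C →ₐ[k] C[X]) (a : A) (c : C) (ha : α a = monomial 1 a)
    (hc : β c = monomial 1 c) :
    tensorCoact α β (a ⊗ₜ 1 + 1 ⊗ₜ c) = monomial 1 (a ⊗ₜ 1 + 1 ⊗ₜ c) := by
  have h1 : tensorCoact α β (a ⊗ₜ 1) = monomial 1 (a ⊗ₜ 1) := by
    refine (Algebra.TensorProduct.lift_tmul _ _ _ _ _).trans ?_
    rw [map_one, mul_one]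
    simp [ha]
  have h2 : tensorCoact α β (1 ⊗ₜ c) = monomial 1 (1 ⊗ₜ c) := by
    refine (Algebra.TensorProduct.lift_tmul _ _ _ _ _).trans ?_
    rw [map_one, one_mul]
    simp [hc]
  rw [map_add, map_add, h1, h2]

theorem comulQuot_ι (I J : Ideal (SymmetricAlgebra k V)) (v : V) :
    comulQuot I J (SymmetricAlgebra.ι k V v) =
      Ideal.Quotient.mk I (SymmetricAlgebra.ι k V v) ⊗ₜ 1 +
        1 ⊗ₜ Ideal.Quotient.mk J (SymmetricAlgebra.ι k V v) := by
  simp [comulQuot]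

theorem isHomog_comulQuot (I J : Ideal (SymmetricAlgebra k V)) (hI : IsHomog I) (hJ : IsHomog J) :
    IsHomog (RingHom.ker (comulQuot I J)) := by
  refine isHomog_ker (comulQuot I J) (tensorCoact (quotCoact I hI) (quotCoact J hJ)) fun v => ?_
  rw [comulQuot_ι]
  exact tensorCoact_add _ _ _ _ (by rw [quotCoact_mk, coact_ι, map_monomial])
    (by rw [quotCoact_mk, coact_ι, map_monomial])

theorem isGraded_quot (I : Ideal (SymmetricAlgebra k V)) (hI : IsHomog I) :
    IsGradedModule (symGrading k V) (quotGrading I) where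
  internal := by
    refine ProjSystem.isInternal ⟨fun j =>
      ((lcoeff _ j).toAddMonoidHom).comp (quotCoact I hI : _ →+ _), ?_, ?_, ?_, ?_⟩
    · intro j x
      obtain ⟨x, rfl⟩ := Ideal.Quotient.mk_surjective x
      exact ⟨(coact k V x).coeff j, coeff_coact_mem x j, by simp [quotCoact_mk]⟩
    · rintro j _ ⟨x, hx, rfl⟩
      simp [quotCoact_mk, coact_of_mem j x hx]
    · rintro i j hij _ ⟨x, hx, rfl⟩
      simp [quotCoact_mk, coact_of_mem i x hx, coeff_monomial, hij]
    · intro x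
      obtain ⟨x, rfl⟩ := Ideal.Quotient.mk_surjective x
      refine ⟨(coact k V x).support, ?_⟩
      conv_rhs => rw [← sum_coeff_coact x]
      simp [quotCoact_mk]
  smul_mem := by
    rintro a b s _ hs ⟨x, hx, rfl⟩
    exact ⟨s * x, symGrading_mul a b s hs x hx, by simp; rfl⟩

theorem isHomog_augIdeal : IsHomog (augIdeal k V) :=
  isHomog_ker _ (Algebra.ofId k _) fun v => by simp [SymmetricAlgebra.algebraMapInv_ι]

end Sym

section Secant

universe u v
open Polynomial

variable {k : Type u} [Field k] {B : Type v} [CommRing B] [Algebra k B] {ℓ : ℕ}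

theorem mulMap_eq (𝓑 : (Fin ℓ → ℕ) → Submodule k B) (d : Fin ℓ → ℕ) :
    mulMap 𝓑 d = (mapAlgHom (SymmetricAlgebra.lift (𝓑 d).subtype)).comp (coact k (𝓑 d)) := by
  ext v
  simp [mulMap, coact_ι]

/-- In degree `m` the first secant ideal is the kernel of the multiplication map
`Sym^m(B_d) → B`. -/
theorem mem_secantIdeal_one (𝓑 : (Fin ℓ → ℕ) → Submodule k B) (d : Fin ℓ → ℕ) (m : ℕ)
    (x : SymmetricAlgebra k (𝓑 d)) (hx : x ∈ symGrading k (𝓑 d) m) :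
    x ∈ secantIdeal 𝓑 d 1 ↔ SymmetricAlgebra.lift (𝓑 d).subtype x = 0 := by
  rw [secantIdeal, RingHom.mem_ker, mulMap_eq]
  simp [coact_of_mem m x hx]

theorem isHomog_secantIdeal (𝓑 : (Fin ℓ → ℕ) → Submodule k B) (d : Fin ℓ → ℕ) :
    ∀ r, IsHomog (secantIdeal 𝓑 d r)
  | 0 => isHomog_augIdeal
  | 1 => by
    have hp : ∀ (x : SymmetricAlgebra k (𝓑 d)), x ∈ secantIdeal 𝓑 d 1 ↔
        ∀ j, SymmetricAlgebra.lift (𝓑 d).subtype ((coact k (𝓑 d) x).coeff j) = 0 := by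
      intro x
      rw [secantIdeal, RingHom.mem_ker, mulMap_eq, Polynomial.ext_iff]
      simp
    intro x hx j
    rw [mem_secantIdeal_one 𝓑 d j _ (coeff_coact_mem x j)]
    exact (hp x).1 hx j
  | r + 2 => isHomog_comulQuot _ _ (isHomog_secantIdeal 𝓑 d 1) (isHomog_secantIdeal 𝓑 d (r + 1))

theorem nonempty_secResolution (𝓑 : (Fin ℓ → ℕ) → Submodule k B) (d : Fin ℓ → ℕ) (r : ℕ) :
    Nonempty (SecResolution 𝓑 d r) :=
  nonempty_gradedProjectiveResolution isInternal_symGrading symGrading_mul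
    (isGraded_quot _ (isHomog_secantIdeal 𝓑 d r))

end Secant

end SecantSyzygies

end

open scoped TensorProduct

noncomputable section

namespace SecantSyzygies

/-! ### Comparison of a graded projective resolution with a free resolution over another ring -/

section Comparison

/-! Fix finitely many homogeneous generators `x i` of `B`. `Sym(B_d)` is a retract of the polynomial
ring `A_d` whose variables are the formal monomials of degree `d` in these generators. Uniformity in
`d` comes from regarding all degrees and all symmetric powers as values of one module over one
category.

An object of this Veronese category is a degree with a number of positions. A morphism embeds the
positions, multiplies the old ones by monomials and fills the new ones with monomials. Morphisms out
of a fixed object are words in letters (mark, monomial), so Higman's lemma applies to divisibility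
between them (`VHom.exists_lt_comp_eq`). A Gröbner basis argument then makes every submodule of a
finitely generated projective finitely generated (`SubFamily.exists_generates`). Hence all iterated
syzygies of a submodule have finitely many generators, chosen without reference to `d`.

The ideal `I(r)` is the kernel of `v ↦ ∑ᵢ ιᵢ(v) Xᵢ`, where the `ιᵢ` are the `r` embeddings of `B`
into its `r`-fold tensor power (`exists_secantIdeal_eq_ker`). Correspondingly, the combinations of
tuples of monomials killed by every distribution of their entries among the `ιᵢ` form a submodule,
`baseFamily`.

In characteristic `0`, averaging over permutations of the positions is exact. It turns a principal
projective in degree `d`, all sizes together, into a free `A_d`-module whose generators sit in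
degree the size of the source object. The syzygies of `baseFamily` thus become a free resolution of
`Sec_{d,r}(B)` over `A_d` (`augMap_eq_zero_iff`, `symGenMap_eq_zero_iff`), with degrees of
generators bounded independently of `d`. Comparison with an arbitrary graded projective resolution
over the retract `Sym(B_d)` gives the bound on Tor (`GradedProjectiveResolution.torDeg_eq_bot`). -/

theorem exists_dependent_seq {α : ℕ → Type*} (good : ∀ n, α n → Prop)
    (rel : ∀ n, α n → α (n + 1) → Prop) (a : α 0) (ha : good 0 a)
    (step : ∀ n x, good n x → ∃ y, good (n + 1) y ∧ rel n x y) :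
    ∃ f : ∀ n, α n, f 0 = a ∧ ∀ n, rel n (f n) (f (n + 1)) := by
  choose F hF hrel using step
  let f : ∀ n, {x : α n // good n x} := fun n =>
    Nat.rec ⟨a, ha⟩ (fun n x => ⟨F n x.1 x.2, hF n x.1 x.2⟩) n
  exact ⟨fun n => (f n).1, rfl, fun n => hrel n _ (f n).2⟩

/-! ### Semilinear maps out of free and projective modules. -/

section Semilinear

variable {R S T : Type*} [CommRing R] [CommRing S] [CommRing T]

/-- The semilinear map on a free module with prescribed values on the basis. -/
def semiComb {Γ F : Type*} [AddCommGroup F] [Module R F] (p : S →+* R) (y : Γ → F) :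
    (Γ →₀ S) →ₛₗ[p] F where
  toFun := Finsupp.liftAddHom fun γ => ((smulAddHom R F).flip (y γ)).comp p.toAddMonoidHom
  map_add' a b := map_add _ a b
  map_smul' a q := by
    induction q using Finsupp.induction_linear with
    | zero => simp
    | add f g hf hg => rw [smul_add, map_add, hf, hg, map_add, smul_add]
    | single γ b =>
      rw [Finsupp.smul_single]
      simp [mul_smul, -Finsupp.single_mul]

theorem semiComb_single {Γ F : Type*} [AddCommGroup F] [Module R F] (p : S →+* R) (y : Γ → F)
    (γ : Γ) (a : S) : semiComb p y (Finsupp.single γ a) = p a • y γ := by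
  simp [semiComb]

/-- The lifting property of projective modules for semilinear maps. -/
theorem exists_semilinear_lift {F Q N : Type*} [AddCommGroup F] [Module R F] [AddCommGroup Q]
    [Module S Q] [AddCommGroup N] [Module T N] (hF : Module.Projective R F) (σ : R →+* S)
    (τ : S →+* T) (u : Q →ₛₗ[τ] N) (θ : F →+ N) (hθ : ∀ r x, θ (r • x) = τ (σ r) • θ x)
    (h : ∀ x, ∃ q, u q = θ x) : ∃ f : F →ₛₗ[σ] Q, ∀ x, u (f x) = θ x := by
  -- `j` splits the canonical surjection from the free module on the set `F`. The lift is `j`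
  -- followed by the map sending each basis element to a chosen preimage, so the choice need not be
  -- additive.
  obtain ⟨j, hj⟩ := Module.projective_def.1 hF
  choose c hc using h
  refine ⟨⟨⟨fun x => semiComb σ c (j x), fun x y => by simp⟩, fun r x => by simp⟩, fun x => ?_⟩
  change u (semiComb σ c (j x)) = θ x
  have key : ∀ q : F →₀ R, u (semiComb σ c q) = θ (Finsupp.linearCombination R id q) := by
    intro q
    induction q using Finsupp.induction_linear with
    | zero => simp
    | add f g hf hg => simp only [map_add, hf, hg]
    | single y r => simp [semiComb_single, hc, hθ]
  rw [key, hj x]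

/-- The degree `n` part of a free module on a graded basis. -/
def freeDeg {Γ : Type*} (𝒯 : ℕ → AddSubgroup S) (sz : Γ → ℕ) (n : ℕ) : AddSubgroup (Γ →₀ S) :=
  AddSubgroup.closure {y | ∃ γ c a, a ∈ 𝒯 c ∧ c + sz γ = n ∧ Finsupp.single γ a = y}

end Semilinear

universe u w

variable {k : Type u} {R : Type w} [CommRing k] [CommRing R] [Algebra k R]
  {𝒮 : ℕ → Submodule k R}

theorem ProjSystem.map_p {F G : Type*} [AddCommGroup F] [AddCommGroup G] {ℱ : ℕ → AddSubgroup F}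
    {𝒢 : ℕ → AddSubgroup G} (A : ProjSystem ℱ) (B : ProjSystem 𝒢) (f : F →+ G)
    (hf : ∀ j, ∀ x ∈ ℱ j, f x ∈ 𝒢 j) (j : ℕ) (x : F) : f (A.p j x) = B.p j (f x) := by
  obtain ⟨s, hs⟩ := A.sum x
  rw [← hs]
  simp only [map_sum]
  refine Finset.sum_congr rfl fun i _ => ?_
  by_cases hij : i = j
  · subst hij
    rw [A.same _ _ (A.mem _ _), B.same _ _ (hf _ _ (A.mem _ _))]
  · rw [A.ne _ _ hij _ (A.mem _ _), B.ne _ _ hij _ (hf _ _ (A.mem _ _)), map_zero]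

/-- Since `𝔪` is homogeneous, so is `𝔪F`, and passing to components does not leave it. -/
theorem ProjSystem.p_mem_smul_top {F : Type w} [AddCommGroup F] [Module R F]
    {ℱ : ℕ → AddSubgroup F} (hF : IsGradedModule 𝒮 ℱ) (A : ProjSystem ℱ) (𝔪 : Ideal R)
    (h𝔪 : ∀ r ∈ 𝔪, ∃ (s : Finset ℕ) (ρ : ℕ → R), (∀ a, ρ a ∈ 𝒮 a ∧ ρ a ∈ 𝔪) ∧
      ∑ a ∈ s, ρ a = r) (j : ℕ) (x : F) (hx : x ∈ 𝔪 • (⊤ : Submodule R F)) :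
    A.p j x ∈ 𝔪 • (⊤ : Submodule R F) := by
  refine Submodule.smul_induction_on hx (fun r hr y _ => ?_) fun x y hx hy => ?_
  · obtain ⟨s, ρ, hρ, rfl⟩ := h𝔪 r hr
    obtain ⟨t, ht⟩ := A.sum y
    rw [← ht, Finset.sum_smul, map_sum]
    refine sum_mem fun a _ => ?_
    rw [Finset.smul_sum, map_sum]
    refine sum_mem fun b _ => ?_
    have h := hF.smul_mem (hρ a).1 (A.mem b y)
    by_cases hab : a + b = j
    · rw [A.same j _ (hab ▸ h)]
      exact Submodule.smul_mem_smul (hρ a).2 trivial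
    · rw [A.ne _ _ hab _ h]
      exact zero_mem _
  · rw [map_add]
    exact add_mem hx hy

theorem tmul_one_eq_zero_iff {F : Type*} [AddCommGroup F] [Module R F] (𝔪 : Ideal R) (x : F) :
    x ⊗ₜ[R] (1 : R ⧸ 𝔪) = 0 ↔ x ∈ 𝔪 • (⊤ : Submodule R F) := by
  rw [← (TensorProduct.tensorQuotEquivQuotSMul F 𝔪).map_eq_zero_iff]
  have : (1 : R ⧸ 𝔪) = Ideal.Quotient.mk 𝔪 1 := rfl
  rw [this, TensorProduct.tensorQuotEquivQuotSMul_tmul_mk, one_smul]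
  exact Submodule.Quotient.mk_eq_zero _

variable {M : Type w} [AddCommGroup M] [Module R M] {ℳ : ℕ → AddSubgroup M}

/-- If a graded module has a resolution by free modules over a ring of which `R` is a retract, whose
`i`-th term has a basis in degrees `≤ C`, then its `i`-th Tor is concentrated in degrees `≤ C`. -/
theorem GradedProjectiveResolution.torDeg_eq_bot (P : GradedProjectiveResolution 𝒮 M ℳ)
    (hM : IsGradedModule 𝒮 ℳ) (𝔪 : Ideal R)
    (h𝔪 : ∀ r ∈ 𝔪, ∃ (s : Finset ℕ) (ρ : ℕ → R), (∀ a, ρ a ∈ 𝒮 a ∧ ρ a ∈ 𝔪) ∧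
      ∑ a ∈ s, ρ a = r) (hpos : ∀ c, 0 < c → ∀ r ∈ 𝒮 c, r ∈ 𝔪)
    {S : Type*} [CommRing S] (p : S →+* R) (s : R →+* S) (hps : ∀ r, p (s r) = r)
    (𝒯 : ℕ → AddSubgroup S) (h𝒯 : ∀ c, ∀ a ∈ 𝒯 c, p a ∈ 𝒮 c) (htop : ⨆ c, 𝒯 c = ⊤)
    {Γ : ℕ → Type*} (sz : ∀ i, Γ i → ℕ) (δ : ∀ i, (Γ (i + 1) →₀ S) →ₗ[S] (Γ i →₀ S))
    (η : (Γ 0 →₀ S) →ₛₗ[p] M)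
    (hδ : ∀ i γ, δ i (Finsupp.single γ 1) ∈ freeDeg 𝒯 (sz i) (sz (i + 1) γ))
    (hη : ∀ γ, η (Finsupp.single γ 1) ∈ ℳ (sz 0 γ)) (hη_surj : Function.Surjective η)
    (hη_exact : Function.Exact (δ 0) η) (hδ_exact : ∀ i, Function.Exact (δ (i + 1)) (δ i))
    {i j C : ℕ} (hC : ∀ γ : Γ i, sz i γ ≤ C) (hj : C < j) : P.torDeg 𝔪 i j = ⊥ := by
  have hA : ∀ i, Nonempty (ProjSystem (P.gr i)) := fun i =>
    ProjSystem.nonempty_of_isInternal (P.isGraded i).internal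
  let A : ∀ i, ProjSystem (P.gr i) := fun i => (hA i).some
  obtain ⟨AM⟩ := ProjSystem.nonempty_of_isInternal hM.internal
  have hdd : ∀ i x, P.d i (P.d (i + 1) x) = 0 := fun i x => (P.exact_d i _).2 ⟨x, rfl⟩
  -- the map from `P` to the free resolution
  obtain ⟨f₀, hf₀⟩ := exists_semilinear_lift (P.projective 0) s p η P.ε.toAddMonoidHom
    (fun r x => by simp [hps]) fun x => hη_surj _
  -- The property carried along the recursion is the one that lets projectivity produce the next
  -- component. The maps need not be homogeneous, since nothing is assumed about degrees under `s`.
  obtain ⟨f, rfl, hf⟩ := exists_dependent_seq (α := fun n => P.F n →ₛₗ[s] (Γ n →₀ S))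
    (fun n a => ∀ x, ∃ q, δ n q = a (P.d n x)) (fun n a b => ∀ x, δ n (b x) = a (P.d n x)) f₀
    (fun x => (hη_exact _).1 (by
      rw [hf₀]
      exact (P.exact_ε _).2 ⟨x, rfl⟩))
    fun n a ha => by
      obtain ⟨b, hb⟩ := exists_semilinear_lift (P.projective (n + 1)) s (RingHom.id S) (δ n)
        (a.toAddMonoidHom.comp (P.d n).toAddMonoidHom) (fun r x => by simp) ha
      refine ⟨b, fun x => (hδ_exact n _).1 ?_, hb⟩
      rw [hb]
      simp [hdd]
  -- the map from the free resolution to `P`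
  have hcomb : ∀ n (y : Γ n → P.F n), (∀ γ, y γ ∈ P.gr n (sz n γ)) → ∀ m,
      ∀ q ∈ freeDeg 𝒯 (sz n) m, semiComb p y q ∈ P.gr n m := by
    intro n y hy m q hq
    induction hq using AddSubgroup.closure_induction with
    | mem x hx =>
      obtain ⟨γ, c, a, ha, rfl, rfl⟩ := hx
      rw [semiComb_single]
      exact (P.isGraded n).smul_mem (h𝒯 c a ha) (hy γ)
    | zero => simp
    | add x y _ _ hx hy =>
      rw [map_add]
      exact add_mem hx hy
    | neg x _ hx =>
      rw [map_neg]
      exact neg_mem hx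
  have hext : ∀ n {F : Type w} [AddCommGroup F] [Module R F] (u v : (Γ n →₀ S) →ₛₗ[p] F),
      (∀ γ, u (Finsupp.single γ 1) = v (Finsupp.single γ 1)) → ∀ q, u q = v q := by
    intro n F _ _ u v h q
    induction q using Finsupp.induction_linear with
    | zero => simp
    | add f g hf hg => rw [map_add, map_add, hf, hg]
    | single γ a =>
      rw [← mul_one a, ← smul_eq_mul, ← Finsupp.smul_single, map_smulₛₗ, map_smulₛₗ, h]
  -- This map, unlike the previous one, must be homogeneous. A component of the right degree of any
  -- preimage of a homogeneous element is still a preimage.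
  have hy₀ : ∀ γ : Γ 0, ∃ y ∈ P.gr 0 (sz 0 γ), P.ε y = η (Finsupp.single γ 1) := by
    intro γ
    obtain ⟨x, hx⟩ := P.surjective_ε (η (Finsupp.single γ 1))
    refine ⟨(A 0).p (sz 0 γ) x, (A 0).mem _ _, ?_⟩
    have := (A 0).map_p AM P.ε.toAddMonoidHom P.ε_mem (sz 0 γ) x
    refine this.trans ?_
    change AM.p _ (P.ε x) = _
    rw [hx, AM.same _ _ (hη γ)]
  choose y₀ hy₀ hεy₀ using hy₀
  have hg₀ : ∀ q, P.ε (semiComb p y₀ q) = η q :=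
    hext 0 (P.ε.comp (semiComb p y₀)) η fun γ => by simp [semiComb_single, hεy₀]
  have hstep : ∀ n (γ : Γ (n + 1)) (z : P.F n), z ∈ P.gr n (sz (n + 1) γ) →
      (∃ x, P.d n x = z) → ∃ y ∈ P.gr (n + 1) (sz (n + 1) γ), P.d n y = z := by
    rintro n γ _ hz ⟨x, rfl⟩
    refine ⟨(A (n + 1)).p (sz (n + 1) γ) x, (A (n + 1)).mem _ _, ?_⟩
    refine ((A (n + 1)).map_p (A n) (P.d n).toAddMonoidHom (P.d_mem n) _ x).trans ?_
    exact (A n).same _ _ hz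
  obtain ⟨y, hy0, hy⟩ := exists_dependent_seq
    (α := fun n => {y : Γ n → P.F n // ∀ γ, y γ ∈ P.gr n (sz n γ)})
    (fun n y => ∀ γ, ∃ x, P.d n x = semiComb p y.1 (δ n (Finsupp.single γ 1)))
    (fun n y y' => ∀ q, P.d n (semiComb p y'.1 q) = semiComb p y.1 (δ n q)) ⟨y₀, hy₀⟩
    (fun γ => (P.exact_ε _).1 (by
      rw [hg₀]
      exact (hη_exact _).2 ⟨_, rfl⟩))
    fun n y hy => by
      choose z hz hdz using fun γ => hstep n γ _ (hcomb n y.1 y.2 _ _ (hδ n γ)) (hy γ)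
      have hz' : ∀ q, P.d n (semiComb p z q) = semiComb p y.1 (δ n q) :=
        hext (n + 1) ((P.d n).comp (semiComb p z)) ((semiComb p y.1).comp (δ n)) fun γ => by
          simp [semiComb_single, hdz]
      refine ⟨⟨z, hz⟩, fun γ => (P.exact_d n _).1 ?_, hz'⟩
      rw [hz', (hδ_exact n _).2 ⟨_, rfl⟩, map_zero]
  -- the composite is homotopic to the identity
  let φ : ∀ n, P.F n →ₗ[R] P.F n := fun n =>
    { toFun := fun x => semiComb p (y n).1 (f n x) - x
      map_add' := fun a b => by
        rw [map_add, map_add]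
        abel
      map_smul' := fun r x => by
        rw [map_smulₛₗ, map_smulₛₗ, hps, RingHom.id_apply, smul_sub] }
  have hφ : ∀ n x, P.d n (φ (n + 1) x) = φ n (P.d n x) := by
    intro n x
    change P.d n (semiComb p (y (n + 1)).1 (f (n + 1) x) - x) =
      semiComb p (y n).1 (f n (P.d n x)) - P.d n x
    rw [map_sub, hy, hf]
  have hφ₀ : ∀ x, P.ε (φ 0 x) = 0 := by
    intro x
    change P.ε (semiComb p (y 0).1 (f 0 x) - x) = 0
    rw [map_sub, hy0, hg₀, hf₀]
    exact sub_self _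
  obtain ⟨h₀, hh₀⟩ := exists_semilinear_lift (P.projective 0) (RingHom.id R) (RingHom.id R) (P.d 0)
    (φ 0).toAddMonoidHom (fun r x => by simp) fun x => (P.exact_ε _).1 (hφ₀ x)
  obtain ⟨h, rfl, hh⟩ := exists_dependent_seq (α := fun n => P.F n →ₗ[R] P.F (n + 1))
    (fun n a => ∀ x, P.d n (φ (n + 1) x - a (P.d n x)) = 0)
    (fun n a b => ∀ x, P.d (n + 1) (b x) = φ (n + 1) x - a (P.d n x)) h₀
    (fun x => by
      rw [map_sub, hφ, hh₀]
      exact sub_self _)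
    fun n a ha => by
      obtain ⟨b, hb⟩ := exists_semilinear_lift (P.projective (n + 1)) (RingHom.id R)
        (RingHom.id R) (P.d (n + 1)) (φ (n + 1) - a.comp (P.d n)).toAddMonoidHom
        (fun r x => by simp [smul_sub]) fun x => (P.exact_d n _).1 (ha x)
      have hb' : ∀ x, P.d (n + 1) (b x) = φ (n + 1) x - a (P.d n x) := hb
      refine ⟨b, fun x => ?_, hb'⟩
      rw [map_sub, hφ, hb', hdd, map_zero, sub_zero, sub_self]
  -- homogeneous components of large degree
  have hcomp : ∀ q : Γ i →₀ S, (A i).p j (semiComb p (y i).1 q) ∈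
      𝔪 • (⊤ : Submodule R (P.F i)) := by
    intro q
    induction q using Finsupp.induction_linear with
    | zero => simp
    | add f g hf hg =>
      rw [map_add, map_add]
      exact add_mem hf hg
    | single γ a =>
      have ha : a ∈ ⨆ c, 𝒯 c := htop ▸ AddSubgroup.mem_top a
      refine AddSubgroup.iSup_induction 𝒯 (C := fun a =>
        (A i).p j (semiComb p (y i).1 (Finsupp.single γ a)) ∈ 𝔪 • (⊤ : Submodule R (P.F i))) ha
        (fun c a ha => ?_) (by simp) fun a b ha hb => ?_
      · have hmem := (P.isGraded i).smul_mem (h𝒯 c a ha) ((y i).2 γ)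
        rw [semiComb_single]
        by_cases hc : c + sz i γ = j
        · rw [(A i).same j _ (hc ▸ hmem)]
          have := hC γ
          exact Submodule.smul_mem_smul (hpos c (by omega) _ (h𝒯 c a ha)) trivial
        · rw [(A i).ne _ _ hc _ hmem]
          exact zero_mem _
      · rw [Finsupp.single_add, map_add, map_add]
        exact add_mem ha hb
  -- The homotopy writes `x` as an element coming from the free resolution, minus `e`, minus a
  -- boundary. In degree `j` the first two terms die modulo `𝔪`.
  have key : ∀ x ∈ P.gr i j, ∀ e ∈ 𝔪 • (⊤ : Submodule R (P.F i)),
      P.d i (h i x) = φ i x - e → x ⊗ₜ[R] (1 : R ⧸ 𝔪) ∈ P.boundaries 𝔪 i := by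
    intro x hx e he hxe
    have h1 : (A i).p j x = (A i).p j (semiComb p (y i).1 (f i x)) - (A i).p j e -
        P.d i ((A (i + 1)).p j (h i x)) := by
      have h2 := (A (i + 1)).map_p (A i) (P.d i).toAddMonoidHom (P.d_mem i) j (h i x)
      change P.d i ((A (i + 1)).p j (h i x)) = (A i).p j (P.d i (h i x)) at h2
      rw [h2, hxe, ← map_sub, ← map_sub]
      congr 1
      change x = _ - e - (_ - x - e)
      abel
    rw [(A i).same j x hx] at h1
    rw [h1, TensorProduct.sub_tmul, (tmul_one_eq_zero_iff 𝔪 _).2 (sub_mem (hcomp _)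
      (ProjSystem.p_mem_smul_top (P.isGraded i) (A i) 𝔪 h𝔪 j e he)), zero_sub]
    exact neg_mem ⟨_ ⊗ₜ 1, LinearMap.rTensor_tmul _ _ _ _⟩
  rw [eq_bot_iff]
  rintro _ ⟨⟨z, hz⟩, ⟨x, hx, rfl⟩, rfl⟩
  refine (Submodule.Quotient.mk_eq_zero _).2 ?_
  change x ⊗ₜ[R] (1 : R ⧸ 𝔪) ∈ P.boundaries 𝔪 i
  cases i with
  | zero =>
    refine key x hx 0 (zero_mem _) ?_
    rw [sub_zero]
    exact hh₀ x
  | succ i =>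
    -- For a cycle modulo `𝔪` the differential lies in `𝔪F`, hence so does its image under the
    -- `R`-linear homotopy.
    refine key x hx (h i (P.d i x)) ?_ (hh i x)
    have h3 : P.d i x ⊗ₜ[R] (1 : R ⧸ 𝔪) = 0 := hz
    rw [← tmul_one_eq_zero_iff]
    have := congrArg ((h i).rTensor (R ⧸ 𝔪)) h3
    rwa [LinearMap.rTensor_tmul, map_zero] at this

end Comparison

/-! ### The Veronese category -/

section Veronese

/-- An object of the Veronese category: a degree `deg` and a number `size` of positions. -/
structure VObj (D : Type*) where
  deg : D
  size : ℕ

variable {N : ℕ} {D : Type*} [AddCommMonoid D]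

/-- A morphism of the Veronese category: an injection of the positions together with a monomial at
every position of the target. -/
@[ext]
structure VHom (δ : (Fin N → ℕ) →+ D) (X Y : VObj D) where
  emb : Fin X.size → Fin Y.size
  mon : Fin Y.size → Fin N → ℕ
  inj : Function.Injective emb
  deg_emb : ∀ i, δ (mon (emb i)) + X.deg = Y.deg
  deg_of_notMem : ∀ j, j ∉ Set.range emb → δ (mon j) = Y.deg

variable {δ : (Fin N → ℕ) →+ D} {X Y Z W : VObj D}

namespace VHom

/-- Composition of morphisms. -/
def comp (ψ : VHom δ Y Z) (φ : VHom δ X Y) : VHom δ X Z where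
  emb := ψ.emb ∘ φ.emb
  mon j := ψ.mon j + Function.extend ψ.emb φ.mon 0 j
  inj := ψ.inj.comp φ.inj
  deg_emb i := by
    rw [Function.comp_apply, ψ.inj.extend_apply, map_add, add_assoc, φ.deg_emb, ψ.deg_emb]
  deg_of_notMem j hj := by
    by_cases h : j ∈ Set.range ψ.emb
    · obtain ⟨i, rfl⟩ := h
      rw [ψ.inj.extend_apply, map_add, φ.deg_of_notMem, ψ.deg_emb]
      rintro ⟨a, rfl⟩
      exact hj ⟨a, rfl⟩
    · rw [Function.extend_apply' _ _ _ h, Pi.zero_apply, add_zero, ψ.deg_of_notMem j h]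

theorem comp_mon_emb (ψ : VHom δ Y Z) (φ : VHom δ X Y) (i : Fin Y.size) :
    (ψ.comp φ).mon (ψ.emb i) = ψ.mon (ψ.emb i) + φ.mon i := by
  simp [comp, ψ.inj.extend_apply]

theorem comp_mon_of_notMem (ψ : VHom δ Y Z) (φ : VHom δ X Y) (j : Fin Z.size)
    (hj : j ∉ Set.range ψ.emb) : (ψ.comp φ).mon j = ψ.mon j := by
  simp [comp, Function.extend_apply' _ _ _ hj]

theorem comp_assoc (χ : VHom δ Z W) (ψ : VHom δ Y Z) (φ : VHom δ X Y) :
    (χ.comp ψ).comp φ = χ.comp (ψ.comp φ) := by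
  refine VHom.ext rfl (funext fun j => ?_)
  by_cases h : j ∈ Set.range χ.emb
  · obtain ⟨i, rfl⟩ := h
    rw [comp_mon_emb]
    by_cases h' : i ∈ Set.range ψ.emb
    · obtain ⟨a, rfl⟩ := h'
      have := comp_mon_emb (χ.comp ψ) φ a
      rw [comp_mon_emb ψ, ← add_assoc, ← comp_mon_emb χ ψ]
      exact this
    · rw [comp_mon_of_notMem ψ φ i h', ← comp_mon_emb χ ψ]
      refine comp_mon_of_notMem _ _ _ ?_
      rintro ⟨a, ha⟩
      exact h' ⟨a, χ.inj ha⟩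
  · rw [comp_mon_of_notMem χ _ j h, comp_mon_of_notMem, comp_mon_of_notMem χ _ j h]
    rintro ⟨a, ha⟩
    exact h ⟨_, ha⟩

/-- The mark of a position: `i + 1` at the image of the position `i`, and `0` off the range. -/
def mark (w : VHom δ X Y) : Fin Y.size → ℕ :=
  Function.extend w.emb (fun i => (i : ℕ) + 1) 0

theorem mark_emb (w : VHom δ X Y) (i : Fin X.size) : w.mark (w.emb i) = i + 1 :=
  w.inj.extend_apply _ _ _

theorem mark_of_notMem (w : VHom δ X Y) (j : Fin Y.size) (hj : j ∉ Set.range w.emb) :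
    w.mark j = 0 :=
  Function.extend_apply' _ _ _ hj

theorem mark_le (w : VHom δ X Y) (j : Fin Y.size) : w.mark j ≤ X.size := by
  by_cases h : j ∈ Set.range w.emb
  · obtain ⟨i, rfl⟩ := h
    rw [mark_emb]
    omega
  · simp [mark_of_notMem w j h]

theorem mark_comp_emb (ψ : VHom δ Y Z) (φ : VHom δ X Y) (i : Fin Y.size) :
    (ψ.comp φ).mark (ψ.emb i) = φ.mark i := by
  by_cases h : i ∈ Set.range φ.emb
  · obtain ⟨a, rfl⟩ := h
    rw [mark_emb]
    exact mark_emb (ψ.comp φ) a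
  · rw [mark_of_notMem φ i h, mark_of_notMem]
    rintro ⟨a, ha⟩
    exact h ⟨a, ψ.inj ha⟩

theorem mark_comp_of_notMem (ψ : VHom δ Y Z) (φ : VHom δ X Y) (j : Fin Z.size)
    (hj : j ∉ Set.range ψ.emb) : (ψ.comp φ).mark j = 0 := by
  refine mark_of_notMem _ _ ?_
  rintro ⟨a, ha⟩
  exact hj ⟨_, ha⟩

/-- The image of position `i` is the only one with mark `i + 1`, so a morphism is encoded by its
word of letters. -/
theorem ext_mark {w w' : VHom δ X Y} (hm : w.mark = w'.mark) (h : w.mon = w'.mon) : w = w' := by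
  refine VHom.ext (funext fun i => ?_) h
  have h1 : w'.mark (w.emb i) = i + 1 := by rw [← hm, mark_emb]
  by_cases h2 : w.emb i ∈ Set.range w'.emb
  · obtain ⟨a, ha⟩ := h2
    rw [← ha, mark_emb] at h1
    rw [← ha, show a = i from Fin.ext (by omega)]
  · rw [mark_of_notMem _ _ h2] at h1
    omega

/-- The condition on the degree of the monomial at a position in terms of its mark. -/
theorem deg_mon (w : VHom δ X Y) (j : Fin Y.size) :
    δ (w.mon j) + (if w.mark j = 0 then 0 else X.deg) = Y.deg := by
  by_cases h : j ∈ Set.range w.emb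
  · obtain ⟨i, rfl⟩ := h
    rw [mark_emb, if_neg (by omega), w.deg_emb]
  · rw [mark_of_notMem w j h, if_pos rfl, add_zero, w.deg_of_notMem j h]

/-- The letter at a position. -/
def letter (w : VHom δ X Y) (j : Fin Y.size) : ℕ × (Fin N → ℕ) := (w.mark j, w.mon j)

/-- A position-wise divisibility along a strictly increasing map comes from a morphism. -/
theorem exists_comp_eq (w : VHom δ X Y) (w' : VHom δ X Z) (g : Fin Y.size → Fin Z.size)
    (hg : StrictMono g) (hmark : ∀ i, w.mark i = w'.mark (g i))
    (hmon : ∀ i, w.mon i ≤ w'.mon (g i)) :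
    ∃ φ : VHom δ Y Z, StrictMono φ.emb ∧ φ.comp w = w' := by
  classical
  have hemb : ∀ i, g (w.emb i) = w'.emb i := by
    intro i
    have h1 := hmark (w.emb i)
    rw [mark_emb] at h1
    by_cases h2 : g (w.emb i) ∈ Set.range w'.emb
    · obtain ⟨a, ha⟩ := h2
      rw [← ha, mark_emb] at h1
      rw [← ha, show a = i from Fin.ext (by omega)]
    · rw [mark_of_notMem _ _ h2] at h1
      omega
  let φ : VHom δ Y Z :=
    { emb := g
      mon := fun j => w'.mon j - Function.extend g w.mon 0 j
      inj := hg.injective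
      deg_emb := fun i => by
        rw [hg.injective.extend_apply]
        -- `D` need not be cancellative, so `Y.deg` is expanded by `deg_mon` and the exponents are
        -- recombined before comparing degrees.
        have h1 := w.deg_mon i
        rw [← h1, ← add_assoc, ← map_add, tsub_add_cancel_of_le (hmon i), hmark i]
        exact w'.deg_mon (g i)
      deg_of_notMem := fun j hj => by
        rw [Function.extend_apply' _ _ _ hj, Pi.zero_apply, tsub_zero]
        refine w'.deg_of_notMem j ?_
        rintro ⟨a, rfl⟩
        exact hj ⟨_, hemb a⟩ }
  refine ⟨φ, hg, VHom.ext (funext hemb) (funext fun j => ?_)⟩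
  change w'.mon j - Function.extend g w.mon 0 j + Function.extend g w.mon 0 j = _
  refine tsub_add_cancel_of_le ?_
  by_cases h : j ∈ Set.range g
  · obtain ⟨i, rfl⟩ := h
    rw [hg.injective.extend_apply]
    exact hmon i
  · rw [Function.extend_apply' _ _ _ h]
    exact zero_le

/-- Higman's lemma for the morphisms with a fixed source. -/
theorem exists_lt_comp_eq (f : ℕ → Σ Y : VObj D, VHom δ X Y) :
    ∃ m n, m < n ∧ ∃ φ : VHom δ (f m).1 (f n).1, StrictMono φ.emb ∧ φ.comp (f m).2 = (f n).2 := by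
  let r : ℕ × (Fin N → ℕ) → ℕ × (Fin N → ℕ) → Prop := fun a b => a.1 = b.1 ∧ a.2 ≤ b.2
  have : IsPreorder _ r :=
    { refl := fun a => ⟨rfl, le_rfl⟩
      trans := fun a b c h h' => ⟨h.1.trans h'.1, h.2.trans h'.2⟩ }
  let s : Set (ℕ × (Fin N → ℕ)) := {a | a.1 ≤ X.size}
  have hs : s.PartiallyWellOrderedOn r := by
    intro u
    -- Marks are bounded by `X.size`, so including the complement `X.size - mark` turns inequality
    -- of marks into equality.
    obtain ⟨m, n, hmn, h⟩ := wellQuasiOrdered_le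
      (fun i => ((u i).1.1, X.size - (u i).1.1, (u i).1.2) : ℕ → ℕ × ℕ × (Fin N → ℕ))
    refine ⟨m, n, hmn, ?_, h.2.2⟩
    have h1 : (u m).1.1 ≤ (u n).1.1 := h.1
    have h2 : X.size - (u m).1.1 ≤ X.size - (u n).1.1 := h.2.1
    have h3 : (u m).1.1 ≤ X.size := (u m).2
    have h4 : (u n).1.1 ≤ X.size := (u n).2
    omega
  -- Higman's lemma compares words along sublists. The resulting map of positions is strictly
  -- increasing, which compatibility with the monomial order requires.
  have hl := Set.PartiallyWellOrderedOn.partiallyWellOrderedOn_sublistForall₂ r hs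
  obtain ⟨m, n, hmn, h⟩ := hl fun i => ⟨List.ofFn (f i).2.letter, by
    intro x hx
    obtain ⟨j, rfl⟩ := (List.mem_ofFn' _ _).1 hx
    exact mark_le _ _⟩
  refine ⟨m, n, hmn, ?_⟩
  obtain ⟨l, hl1, hl2⟩ := List.sublistForall₂_iff.1 h
  obtain ⟨e, he⟩ := List.sublist_iff_exists_fin_orderEmbedding_get_eq.1 hl2
  obtain ⟨hlen, hget⟩ := List.forall₂_iff_get.1 hl1
  have hlen' : (f m).1.size = l.length := by simpa using hlen
  have hlen2 : (List.ofFn (f n).2.letter).length = (f n).1.size := List.length_ofFn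
  have key : ∀ i : Fin (f m).1.size, r ((f m).2.letter i)
      ((f n).2.letter (Fin.cast hlen2 (e (Fin.cast hlen' i)))) := by
    intro i
    have h1 := hget i (by simp) (by omega)
    have h2 := he (Fin.cast hlen' i)
    rw [List.get_ofFn] at h2
    have h3 : l.get ⟨i, by omega⟩ = l.get (Fin.cast hlen' i) := rfl
    rw [h3, h2] at h1
    simpa using h1
  exact exists_comp_eq _ _ (fun i => Fin.cast hlen2 (e (Fin.cast hlen' i)))
    (fun a b hab => e.strictMono hab) (fun i => (key i).1) fun i => (key i).2

/-- Every family of morphisms with a fixed source is generated by finitely many of its members. -/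
theorem exists_finset_generating (S : Set (Σ Y : VObj D, VHom δ X Y)) :
    ∃ T : Finset (Σ Y : VObj D, VHom δ X Y), (∀ a ∈ T, a ∈ S) ∧ ∀ b ∈ S, ∃ a ∈ T,
      ∃ φ : VHom δ a.1 b.1, StrictMono φ.emb ∧ φ.comp a.2 = b.2 := by
  by_contra! hcon
  -- If no finite subset generates, one can keep choosing members not generated by the earlier ones,
  -- against Higman's lemma.
  obtain ⟨f, -, hf⟩ := exists_seq_of_forall_finset_exists (· ∈ S)
    (fun a b => ∀ φ : VHom δ a.1 b.1, StrictMono φ.emb → φ.comp a.2 ≠ b.2) hcon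
  obtain ⟨m, n, hmn, φ, h1, h2⟩ := exists_lt_comp_eq f
  exact hf m n hmn φ h1 h2

end VHom

/-! ### Noetherianity -/

variable {t : ℕ}

/-- The basis of the direct sum of the principal projectives at `L b` evaluated at `Y`. -/
abbrev Word (δ : (Fin N → ℕ) →+ D) (L : Fin t → VObj D) (Y : VObj D) : Type :=
  Σ b, VHom δ (L b) Y

/-- Postcomposition on words. -/
def Word.push {L : Fin t → VObj D} (ψ : VHom δ Y Z) (p : Word δ L Y) : Word δ L Z :=
  ⟨p.1, ψ.comp p.2⟩

/-- The monomial order on words. -/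
def Word.key {L : Fin t → VObj D} (p : Word δ L Y) :
    Fin t ×ₗ Lex (Fin Y.size → Lex (Fin (N + 1) → ℕ)) :=
  toLex (p.1, toLex fun j => toLex (Fin.cons (p.2.mark j) (p.2.mon j)))

theorem Word.key_injective {L : Fin t → VObj D} :
    Function.Injective (Word.key : Word δ L Y → _) := by
  rintro ⟨b, w⟩ ⟨b', w'⟩ h
  have h1 := toLex.injective h
  obtain rfl : b = b' := (Prod.ext_iff.1 h1).1
  have h2 : ∀ j, (Fin.cons (w.mark j) (w.mon j) : Fin (N + 1) → ℕ) =
      Fin.cons (w'.mark j) (w'.mon j) := fun j =>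
    toLex.injective (congrFun (toLex.injective (Prod.ext_iff.1 h1).2) j)
  have h3 : w = w' := VHom.ext_mark (funext fun j => (Fin.cons_inj.1 (h2 j)).1)
    (funext fun j => (Fin.cons_inj.1 (h2 j)).2)
  rw [h3]

/-- Inserted positions carry the same letter in both words. As `ψ.emb` is increasing, the first
difference moves to its image, where both letters are translated by the same vector. -/
theorem Word.key_push_lt {L : Fin t → VObj D} (ψ : VHom δ Y Z) (hψ : StrictMono ψ.emb)
    {p q : Word δ L Y} (h : p.key < q.key) : (p.push ψ).key < (q.push ψ).key := by
  rcases Prod.Lex.toLex_lt_toLex.1 h with h | ⟨h1, i, h2, h3⟩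
  · exact Prod.Lex.toLex_lt_toLex.2 (Or.inl h)
  refine Prod.Lex.toLex_lt_toLex.2 (Or.inr ⟨h1, ψ.emb i, fun j hj => ?_, ?_⟩)
  · by_cases hr : j ∈ Set.range ψ.emb
    · obtain ⟨a, rfl⟩ := hr
      have h5 : (Fin.cons (p.2.mark a) (p.2.mon a) : Fin (N + 1) → ℕ) =
          Fin.cons (q.2.mark a) (q.2.mon a) := h2 a (hψ.lt_iff_lt.1 hj)
      have h4 := Fin.cons_inj.1 h5
      simp only [Word.push, Pi.toLex_apply, VHom.mark_comp_emb, VHom.comp_mon_emb, h4.1, h4.2]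
    · simp only [Word.push, Pi.toLex_apply, VHom.mark_comp_of_notMem _ _ j hr,
        VHom.comp_mon_of_notMem _ _ j hr]
  · have key : ∀ w : Word δ L Y, (toLex (Fin.cons ((w.push ψ).2.mark (ψ.emb i))
        ((w.push ψ).2.mon (ψ.emb i))) : Lex (Fin (N + 1) → ℕ)) =
        toLex (Fin.cons 0 (ψ.mon (ψ.emb i))) + toLex (Fin.cons (w.2.mark i) (w.2.mon i)) := by
      intro w
      refine toLex.symm.injective (funext fun a => ?_)
      change (Fin.cons _ _ : Fin (N + 1) → ℕ) a =
        (Fin.cons _ _ : Fin (N + 1) → ℕ) a + (Fin.cons _ _ : Fin (N + 1) → ℕ) a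
      refine Fin.cases ?_ (fun a => ?_) a
      · simp [Word.push, VHom.mark_comp_emb]
      · simp [Word.push, VHom.comp_mon_emb]
    simp only [Pi.toLex_apply] at h3 ⊢
    rw [key p, key q]
    exact add_lt_add_right h3 _

variable (k : Type*) [Field k]

/-- Postcomposition on linear combinations of words. -/
def pushMap {L : Fin t → VObj D} (ψ : VHom δ Y Z) :
    (Word δ L Y →₀ k) →ₗ[k] (Word δ L Z →₀ k) :=
  Finsupp.lmapDomain k k (Word.push ψ)

theorem pushMap_single {L : Fin t → VObj D} (ψ : VHom δ Y Z) (p : Word δ L Y) (c : k) :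
    pushMap k ψ (Finsupp.single p c) = Finsupp.single (p.push ψ) c :=
  Finsupp.mapDomain_single

theorem pushMap_comp {L : Fin t → VObj D} (χ : VHom δ Z W) (ψ : VHom δ Y Z)
    (x : Word δ L Y →₀ k) : pushMap k (χ.comp ψ) x = pushMap k χ (pushMap k ψ x) := by
  have : (pushMap k (χ.comp ψ) : (Word δ L Y →₀ k) →ₗ[k] _) = pushMap k χ ∘ₗ pushMap k ψ := by
    ext p : 2
    simp [pushMap_single, Word.push, VHom.comp_assoc]
  exact LinearMap.congr_fun this x

/-- A submodule of a finitely generated projective module over the Veronese category. -/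
structure SubFamily (δ : (Fin N → ℕ) →+ D) where
  t : ℕ
  L : Fin t → VObj D
  K : ∀ Y, Submodule k (Word δ L Y →₀ k)
  closed : ∀ {Y Z} (ψ : VHom δ Y Z), ∀ x ∈ K Y, pushMap k ψ x ∈ K Z

variable {k}

/-- A word is the leading word of some element of the family. -/
def SubFamily.IsLeading (𝒦 : SubFamily k δ) (b : Fin 𝒦.t) (a : Σ Y, VHom δ (𝒦.L b) Y) : Prop :=
  ∃ x ∈ 𝒦.K a.1, x ⟨b, a.2⟩ ≠ 0 ∧ ∀ q : Word δ 𝒦.L a.1, x q ≠ 0 → q.key ≤ Word.key ⟨b, a.2⟩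

/-- A finite set of elements of a family generates it. -/
def SubFamily.Generates (𝒦 : SubFamily k δ) {t' : ℕ}
    (κ : Fin t' → Σ Y, Word δ 𝒦.L Y →₀ k) : Prop :=
  ∀ Y, 𝒦.K Y = Submodule.span k {x | ∃ c, ∃ ψ : VHom δ (κ c).1 Y, pushMap k ψ (κ c).2 = x}

/-- Gröbner bases: for each summand finitely many leading words generate all leading words, and
elements realizing them generate the family by division. -/
theorem SubFamily.exists_generates (𝒦 : SubFamily k δ) :
    ∃ (t' : ℕ) (κ : Fin t' → Σ Y, Word δ 𝒦.L Y →₀ k), 𝒦.Generates κ := by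
  classical
  choose T hT hgen using fun b => VHom.exists_finset_generating {a | 𝒦.IsLeading b a}
  choose! x hxK hx0 hxle using fun b a (ha : a ∈ T b) => hT b a ha
  let I : Type _ := Σ b, {a // a ∈ T b}
  obtain ⟨t', ⟨e⟩⟩ := Finite.exists_equiv_fin I
  let y : I → Σ Y, Word δ 𝒦.L Y →₀ k := fun i => ⟨i.2.1.1, x i.1 i.2.1⟩
  refine ⟨t', fun c => y (e.symm c), fun Y => le_antisymm ?_ ?_⟩
  swap
  · rw [Submodule.span_le]
    rintro _ ⟨c, ψ, rfl⟩
    exact 𝒦.closed ψ _ (hxK _ _ (e.symm c).2.2)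
  set U : Submodule k (Word δ 𝒦.L Y →₀ k) := Submodule.span k
    {z | ∃ c, ∃ ψ : VHom δ (y (e.symm c)).1 Y, pushMap k ψ (y (e.symm c)).2 = z} with hU
  have hUK : U ≤ 𝒦.K Y := by
    rw [hU, Submodule.span_le]
    rintro _ ⟨c, ψ, rfl⟩
    exact 𝒦.closed ψ _ (hxK _ _ (e.symm c).2.2)
  -- One division step: a multiple of a pushed generator with the same leading word is subtracted.
  have reduce : ∀ (p : Word δ 𝒦.L Y), ∀ z ∈ 𝒦.K Y, z p ≠ 0 → (∀ q, z q ≠ 0 → q.key ≤ p.key) →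
      ∃ z' ∈ 𝒦.K Y, z - z' ∈ U ∧ ∀ q, z' q ≠ 0 → q.key < p.key := by
    rintro ⟨b, w⟩ z hz hzp hzle
    obtain ⟨a, ha, φ, hφ, hφw⟩ := hgen b ⟨Y, w⟩ ⟨z, hz, hzp, hzle⟩
    have hinj : Function.Injective (Word.push φ : Word δ 𝒦.L a.1 → _) := by
      intro p q h
      rcases lt_trichotomy p.key q.key with h' | h' | h'
      · exact absurd (congrArg Word.key h) (Word.key_push_lt φ hφ h').ne
      · exact Word.key_injective h'
      · exact absurd (congrArg Word.key h) (Word.key_push_lt φ hφ h').ne'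
    have hpush : Word.push φ (⟨b, a.2⟩ : Word δ 𝒦.L a.1) = ⟨b, w⟩ := by
      simp only [Word.push]
      exact congrArg (Sigma.mk b) hφw
    set v : Word δ 𝒦.L Y →₀ k := pushMap k φ (x b a) with hv
    have hvU : v ∈ U := by
      refine Submodule.subset_span ⟨e ⟨b, a, ha⟩, ?_⟩
      rw [Equiv.symm_apply_apply]
      exact ⟨φ, rfl⟩
    have hvp : v ⟨b, w⟩ = x b a ⟨b, a.2⟩ := by
      rw [← hpush]
      exact Finsupp.mapDomain_apply hinj _ _
    have hvle : ∀ q, v q ≠ 0 → q.key ≤ Word.key (⟨b, w⟩ : Word δ 𝒦.L Y) := by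
      intro q hq
      obtain ⟨q', hq', rfl⟩ := Finset.mem_image.1
        (Finsupp.mapDomain_support (Finsupp.mem_support_iff.2 hq))
      rw [← hpush]
      rcases (hxle b a ha q' (Finsupp.mem_support_iff.1 hq')).lt_or_eq with h | h
      · exact (Word.key_push_lt φ hφ h).le
      · rw [Word.key_injective h]
    have hv0 : v ⟨b, w⟩ ≠ 0 := by
      rw [hvp]
      exact hx0 b a ha
    refine ⟨z - (z ⟨b, w⟩ / v ⟨b, w⟩) • v, sub_mem hz (Submodule.smul_mem _ _ (hUK hvU)), ?_, ?_⟩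
    · rw [sub_sub_cancel]
      exact Submodule.smul_mem _ _ hvU
    · intro q hq
      have hle : q.key ≤ Word.key (⟨b, w⟩ : Word δ 𝒦.L Y) := by
        by_contra hcon
        have h1 : z q = 0 := not_imp_comm.1 (hzle q) hcon
        have h2 : v q = 0 := not_imp_comm.1 (hvle q) hcon
        exact hq (by simp [h1, h2])
      refine lt_of_le_of_ne hle fun h => hq ?_
      rw [Word.key_injective h]
      simp [div_mul_cancel₀ _ hv0]
  have hlead : ∀ z : Word δ 𝒦.L Y →₀ k, z ≠ 0 → ∃ p, z p ≠ 0 ∧ ∀ q, z q ≠ 0 → q.key ≤ p.key := by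
    intro z hz
    obtain ⟨p, hp, hmax⟩ := z.support.exists_max_image Word.key (Finsupp.support_nonempty_iff.2 hz)
    exact ⟨p, Finsupp.mem_support_iff.1 hp, fun q hq => hmax q (Finsupp.mem_support_iff.2 hq)⟩
  -- Division terminates: for fixed `Y` the keys are finite tuples ordered lexicographically, a
  -- well-order.
  have main : ∀ c : Fin 𝒦.t ×ₗ Lex (Fin Y.size → Lex (Fin (N + 1) → ℕ)), ∀ p : Word δ 𝒦.L Y,
      p.key = c → ∀ z ∈ 𝒦.K Y, z p ≠ 0 → (∀ q, z q ≠ 0 → q.key ≤ p.key) → z ∈ U := by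
    intro c
    induction c using WellFoundedLT.induction with
    | ind c ih =>
      rintro p rfl z hz hzp hzle
      obtain ⟨z', hz', hsub, hlt⟩ := reduce p z hz hzp hzle
      have : z' ∈ U := by
        rcases eq_or_ne z' 0 with rfl | h0
        · exact zero_mem _
        obtain ⟨p', hp', hp'le⟩ := hlead z' h0
        exact ih _ (hlt p' hp') p' rfl z' hz' hp' hp'le
      simpa using add_mem hsub this
  intro z hz
  rcases eq_or_ne z 0 with rfl | h0
  · exact zero_mem _
  obtain ⟨p, hp, hple⟩ := hlead z h0
  exact main _ p rfl z hz hp hple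

end Veronese

/-! ### From modules over the Veronese category to free modules over polynomial rings. -/

section Symmetrization

theorem exists_perm_of_card_fiber_eq {ι X : Type*} [Fintype ι] [DecidableEq X] (f f' : ι → X)
    (h : ∀ x, ∑ j, (if f j = x then 1 else 0) = ∑ j, (if f' j = x then 1 else 0)) :
    ∃ g : Equiv.Perm ι, ∀ j, f' (g j) = f j := by
  have h' : ∀ x, Nonempty ({j // f j = x} ≃ {j // f' j = x}) := by
    intro x
    rw [← Fintype.card_eq, Fintype.card_subtype, Fintype.card_subtype, Finset.card_filter,
      Finset.card_filter]
    exact h x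
  let g : Equiv.Perm ι := (Equiv.sigmaFiberEquiv f).symm.trans
    ((Equiv.sigmaCongrRight fun x => (h' x).some).trans (Equiv.sigmaFiberEquiv f'))
  exact ⟨g, fun j => ((h' (f j)).some ⟨j, rfl⟩).2⟩

variable {N : ℕ} {D : Type*} [AddCommMonoid D] {δ : (Fin N → ℕ) →+ D} {X Y Z : VObj D}
variable {t : ℕ} {L : Fin t → VObj D}
variable {k : Type*} [Field k]

/-! #### The map of projectives given by a finite family of elements -/

/-- The map from a direct sum of principal projectives given by the elements `κ c`. -/
def genMap {t' : ℕ} (κ : Fin t' → Σ Y, Word δ L Y →₀ k) (Y : VObj D) :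
    (Word δ (fun c => (κ c).1) Y →₀ k) →ₗ[k] (Word δ L Y →₀ k) :=
  Finsupp.linearCombination k fun p => pushMap k p.2 (κ p.1).2

theorem genMap_single {t' : ℕ} (κ : Fin t' → Σ Y, Word δ L Y →₀ k) (Y : VObj D)
    (p : Word δ (fun c => (κ c).1) Y) :
    genMap κ Y (Finsupp.single p 1) = pushMap k p.2 (κ p.1).2 := by
  simp [genMap]

theorem genMap_pushMap {t' : ℕ} (κ : Fin t' → Σ Y, Word δ L Y →₀ k) (ψ : VHom δ Y Z)
    (x : Word δ (fun c => (κ c).1) Y →₀ k) :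
    genMap κ Z (pushMap k ψ x) = pushMap k ψ (genMap κ Y x) := by
  have : genMap κ Z ∘ₗ pushMap k ψ = pushMap k ψ ∘ₗ genMap κ Y := by
    ext p : 2
    simp [pushMap_single, genMap_single, Word.push, pushMap_comp]
  exact LinearMap.congr_fun this x

theorem SubFamily.Generates.range_genMap {𝒦 : SubFamily k δ} {t' : ℕ}
    {κ : Fin t' → Σ Y, Word δ 𝒦.L Y →₀ k} (h : 𝒦.Generates κ) (Y : VObj D) :
    LinearMap.range (genMap κ Y) = 𝒦.K Y := by
  rw [h Y, genMap, Finsupp.range_linearCombination]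
  congr 1
  ext x
  constructor
  · rintro ⟨p, rfl⟩
    exact ⟨p.1, p.2, rfl⟩
  · rintro ⟨c, ψ, rfl⟩
    exact ⟨⟨c, ψ⟩, rfl⟩

/-- The family of kernels of the map given by the elements `κ c`. -/
def kerFamily {t' : ℕ} (κ : Fin t' → Σ Y, Word δ L Y →₀ k) : SubFamily k δ where
  t := t'
  L := fun c => (κ c).1
  K Y := LinearMap.ker (genMap κ Y)
  closed ψ x hx := by
    rw [LinearMap.mem_ker] at hx ⊢
    rw [genMap_pushMap, hx, map_zero]

/-! #### Free modules over polynomial rings -/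

variable (δ) in
/-- The variables of the polynomial ring in degree `e`: the monomials of degree `e`. -/
abbrev MonOf (e : D) : Type := {α : Fin N → ℕ // δ α = e}

variable (δ L) in
/-- The basis of the free module in degree `e`. -/
abbrev Gen (e : D) : Type := Σ b, Fin (L b).size → {α : Fin N → ℕ // δ α + (L b).deg = e}

variable {e : D} {n n' : ℕ}

/-- The marked monomials of a word. -/
def Word.restr (p : Word δ L ⟨e, n⟩) : Gen δ L e :=
  ⟨p.1, fun i => ⟨p.2.mon (p.2.emb i), p.2.deg_emb i⟩⟩

namespace VHom

open Classical in
/-- The exponent contributed by a position. -/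
def expAt (w : VHom δ X ⟨e, n⟩) (j : Fin n) : MonOf δ e →₀ ℕ :=
  if h : j ∈ Set.range w.emb then 0 else Finsupp.single ⟨w.mon j, w.deg_of_notMem j h⟩ 1

theorem expAt_emb (w : VHom δ X ⟨e, n⟩) (i : Fin X.size) : w.expAt (w.emb i) = 0 :=
  dif_pos ⟨i, rfl⟩

theorem expAt_of_notMem (w : VHom δ X ⟨e, n⟩) (j : Fin n) (h : j ∉ Set.range w.emb) :
    w.expAt j = Finsupp.single ⟨w.mon j, w.deg_of_notMem j h⟩ 1 :=
  dif_neg h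

/-- The exponent of the product of the unmarked monomials of a word. -/
def exps (w : VHom δ X ⟨e, n⟩) : MonOf δ e →₀ ℕ := ∑ j, w.expAt j

/-- The unmarked positions of the composite are those off the range of `ρ` and the images of those
of `w`. By `hρ` the latter keep their monomials. -/
theorem exps_comp (ρ : VHom δ ⟨e, n⟩ ⟨e, n'⟩) (hρ : ∀ i, ρ.mon (ρ.emb i) = 0)
    (w : VHom δ X ⟨e, n⟩) : (ρ.comp w).exps = ρ.exps + w.exps := by
  have h : ∀ j, (ρ.comp w).expAt j = ρ.expAt j + Function.extend ρ.emb w.expAt 0 j := by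
    intro j
    by_cases hj : j ∈ Set.range ρ.emb
    · obtain ⟨i, rfl⟩ := hj
      rw [ρ.inj.extend_apply, expAt_emb, zero_add]
      by_cases hi : i ∈ Set.range w.emb
      · obtain ⟨a, rfl⟩ := hi
        rw [expAt_emb]
        exact expAt_emb (ρ.comp w) a
      · rw [expAt_of_notMem w i hi, expAt_of_notMem]
        · congr 2
          rw [comp_mon_emb, hρ, zero_add]
        · rintro ⟨a, ha⟩
          exact hi ⟨a, ρ.inj ha⟩
    · rw [Function.extend_apply' _ _ _ hj, Pi.zero_apply, add_zero, expAt_of_notMem ρ j hj,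
        expAt_of_notMem]
      · congr 2
        rw [comp_mon_of_notMem _ _ _ hj]
      · rintro ⟨a, ha⟩
        exact hj ⟨_, ha⟩
  rw [exps, Finset.sum_congr rfl fun j _ => h j, Finset.sum_add_distrib]
  congr 1
  exact (Fintype.sum_of_injective ρ.emb ρ.inj w.expAt (Function.extend ρ.emb w.expAt 0)
    (fun j hj => Function.extend_apply' _ _ _ hj) fun i => (ρ.inj.extend_apply _ _ _).symm).symm

/-- A sum over the letters of a word in terms of the marked monomials and the exponent. -/
theorem sum_letter (w : VHom δ X ⟨e, n⟩) (f : ℕ × (Fin N → ℕ) → ℕ) :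
    ∑ j, f (w.letter j) = ∑ i : Fin X.size, f ((i : ℕ) + 1, w.mon (w.emb i)) +
      Finsupp.linearCombination ℕ (fun α : MonOf δ e => f (0, α.1)) w.exps := by
  classical
  have h : ∀ j, f (w.letter j) = Function.extend w.emb
      (fun i : Fin X.size => f ((i : ℕ) + 1, w.mon (w.emb i))) 0 j +
      Finsupp.linearCombination ℕ (fun α : MonOf δ e => f (0, α.1)) (w.expAt j) := by
    intro j
    by_cases hj : j ∈ Set.range w.emb
    · obtain ⟨i, rfl⟩ := hj
      rw [w.inj.extend_apply, expAt_emb, map_zero, add_zero, letter, mark_emb]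
    · rw [Function.extend_apply' _ _ _ hj, expAt_of_notMem w j hj, letter, mark_of_notMem w j hj]
      simp
  rw [Finset.sum_congr rfl fun j _ => h j, Finset.sum_add_distrib, exps, map_sum]
  congr 1
  exact (Fintype.sum_of_injective w.emb w.inj _ (Function.extend w.emb
    (fun i : Fin X.size => f ((i : ℕ) + 1, w.mon (w.emb i))) 0) (fun j hj => Function.extend_apply' _ _ _ hj) fun i => (w.inj.extend_apply _ _ _).symm).symm

theorem size_add_degree_exps (w : VHom δ X ⟨e, n⟩) : X.size + w.exps.degree = n := by
  have h := w.sum_letter fun _ => 1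
  simp only [Finset.sum_const, Finset.card_univ, Fintype.card_fin, smul_eq_mul, mul_one] at h
  rw [Finsupp.linearCombination_apply, Finsupp.sum] at h
  simpa [Finsupp.degree_apply] using h.symm

variable (δ e) in
/-- The automorphism given by a permutation of the positions. -/
def perm (g : Equiv.Perm (Fin n)) : VHom δ ⟨e, n⟩ ⟨e, n⟩ where
  emb := g
  mon := 0
  inj := g.injective
  deg_emb i := by simp
  deg_of_notMem j hj := absurd (g.surjective j) hj

theorem exps_perm (g : Equiv.Perm (Fin n)) : (perm δ e g).exps = 0 :=
  Finset.sum_eq_zero fun j _ => dif_pos (g.surjective j)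

theorem perm_comp_perm (g h : Equiv.Perm (Fin n)) :
    (perm δ e g).comp (perm δ e h) = perm δ e (g * h) := by
  refine VHom.ext rfl (funext fun j => ?_)
  obtain ⟨i, rfl⟩ := g.surjective j
  exact (comp_mon_emb (perm δ e g) (perm δ e h) i).trans (by simp [perm])

/-- Words with the same marked monomials and the same exponent are conjugate. -/
theorem exists_perm_comp_eq (w w' : VHom δ X ⟨e, n⟩)
    (h : ∀ i, w.mon (w.emb i) = w'.mon (w'.emb i)) (h' : w.exps = w'.exps) :
    ∃ g, (perm δ e g).comp w = w' := by
  classical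
  -- Applied to an indicator function, `sum_letter` shows that the marked monomials and the exponent
  -- determine how often each letter occurs.
  obtain ⟨g, hg⟩ := exists_perm_of_card_fiber_eq w.letter w'.letter fun x => by
    rw [w.sum_letter fun y => if y = x then 1 else 0, w'.sum_letter fun y => if y = x then 1 else 0,
      h']
    simp only [h]
  refine ⟨g, ext_mark (funext fun j => ?_) (funext fun j => ?_)⟩
  · obtain ⟨i, rfl⟩ := g.surjective j
    exact (mark_comp_emb (perm δ e g) w i).trans (congrArg Prod.fst (hg i)).symm
  · obtain ⟨i, rfl⟩ := g.surjective j
    refine (comp_mon_emb (perm δ e g) w i).trans ?_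
    refine Eq.trans ?_ (congrArg Prod.snd (hg i)).symm
    exact zero_add _

end VHom

theorem Word.restr_push (ρ : VHom δ ⟨e, n⟩ ⟨e, n'⟩) (hρ : ∀ i, ρ.mon (ρ.emb i) = 0)
    (p : Word δ L ⟨e, n⟩) : (p.push ρ).restr = p.restr := by
  refine congrArg (Sigma.mk p.1) (funext fun i => Subtype.ext ?_)
  exact (VHom.comp_mon_emb ρ p.2 (p.2.emb i)).trans (by rw [hρ, zero_add])

variable (k) in
/-- The symmetrization map to the free module over the polynomial ring. -/
def symMap (δ : (Fin N → ℕ) →+ D) (L : Fin t → VObj D) (e : D) (n : ℕ) :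
    (Word δ L ⟨e, n⟩ →₀ k) →ₗ[k] (Gen δ L e →₀ MvPolynomial (MonOf δ e) k) :=
  Finsupp.linearCombination k fun p => Finsupp.single p.restr (MvPolynomial.monomial p.2.exps 1)

theorem symMap_single (p : Word δ L ⟨e, n⟩) : symMap k δ L e n (Finsupp.single p 1) =
    Finsupp.single p.restr (MvPolynomial.monomial p.2.exps 1) := by
  simp [symMap]

theorem symMap_pushMap (ρ : VHom δ ⟨e, n⟩ ⟨e, n'⟩) (hρ : ∀ i, ρ.mon (ρ.emb i) = 0)
    (x : Word δ L ⟨e, n⟩ →₀ k) : symMap k δ L e n' (pushMap k ρ x) =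
      (MvPolynomial.monomial ρ.exps 1 : MvPolynomial (MonOf δ e) k) • symMap k δ L e n x := by
  have : symMap k δ L e n' ∘ₗ pushMap k ρ = (LinearMap.lsmul (MvPolynomial (MonOf δ e) k) _
      (MvPolynomial.monomial ρ.exps 1)).restrictScalars k ∘ₗ symMap k δ L e n := by
    ext p : 2
    simp only [LinearMap.comp_apply, Finsupp.lsingle_apply, pushMap_single, symMap_single,
      LinearMap.restrictScalars_apply, LinearMap.lsmul_apply, Finsupp.smul_single, smul_eq_mul,
      MvPolynomial.monomial_mul, mul_one, Word.restr_push ρ hρ]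
    rw [← VHom.exps_comp ρ hρ]
    rfl
  exact LinearMap.congr_fun this x

/-! #### Averaging over the symmetric group -/

variable (k) in
/-- The average over the permutations of the positions. -/
def av (δ : (Fin N → ℕ) →+ D) (L : Fin t → VObj D) (e : D) (n : ℕ) :
    (Word δ L ⟨e, n⟩ →₀ k) →ₗ[k] (Word δ L ⟨e, n⟩ →₀ k) :=
  ((n.factorial : k)⁻¹) • ∑ g : Equiv.Perm (Fin n), pushMap k (VHom.perm δ e g)

theorem av_apply (x : Word δ L ⟨e, n⟩ →₀ k) : av k δ L e n x =
    ((n.factorial : k)⁻¹) • ∑ g : Equiv.Perm (Fin n), pushMap k (VHom.perm δ e g) x := by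
  simp [av]

theorem av_pushMap_perm (g : Equiv.Perm (Fin n)) (x : Word δ L ⟨e, n⟩ →₀ k) :
    av k δ L e n (pushMap k (VHom.perm δ e g) x) = av k δ L e n x := by
  rw [av_apply, av_apply]
  congr 1
  refine Fintype.sum_equiv (Equiv.mulRight g) _ _ fun h => ?_
  rw [← pushMap_comp, VHom.perm_comp_perm]
  rfl

theorem pushMap_perm_av (g : Equiv.Perm (Fin n)) (x : Word δ L ⟨e, n⟩ →₀ k) :
    pushMap k (VHom.perm δ e g) (av k δ L e n x) = av k δ L e n x := by
  rw [av_apply, map_smul, map_sum]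
  congr 1
  refine Fintype.sum_equiv (Equiv.mulLeft g) _ _ fun h => ?_
  rw [← pushMap_comp, VHom.perm_comp_perm]
  rfl

theorem genMap_av {t' : ℕ} (κ : Fin t' → Σ Y, Word δ L Y →₀ k)
    (x : Word δ (fun c => (κ c).1) ⟨e, n⟩ →₀ k) :
    genMap κ _ (av k δ _ e n x) = av k δ L e n (genMap κ _ x) := by
  simp only [av_apply, map_smul, map_sum, genMap_pushMap]

/-- Symmetrization forgets the order of the positions, so all `n!` summands agree, and `n!` is
invertible. -/
theorem symMap_av [CharZero k] (x : Word δ L ⟨e, n⟩ →₀ k) :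
    symMap k δ L e n (av k δ L e n x) = symMap k δ L e n x := by
  rw [av_apply, map_smul, map_sum, Finset.sum_congr rfl fun g _ => symMap_pushMap _ (fun _ => rfl) x]
  simp only [VHom.exps_perm, MvPolynomial.monomial_zero', map_one, one_smul, Finset.sum_const,
    Finset.card_univ, Fintype.card_perm, Fintype.card_fin]
  rw [← Nat.cast_smul_eq_nsmul k, smul_smul, inv_mul_cancel₀, one_smul]
  exact_mod_cast n.factorial_ne_zero

/-! #### All sizes together -/

variable (k) in
/-- Linear combinations of words of degree `e` of all sizes. -/
abbrev Tot (δ : (Fin N → ℕ) →+ D) (L : Fin t → VObj D) (e : D) : Type _ :=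
  Π₀ n : ℕ, Word δ L ⟨e, n⟩ →₀ k

variable (k) in
/-- The symmetrization map on words of all sizes. -/
def symTot (δ : (Fin N → ℕ) →+ D) (L : Fin t → VObj D) (e : D) :
    Tot k δ L e →ₗ[k] (Gen δ L e →₀ MvPolynomial (MonOf δ e) k) :=
  DFinsupp.lsum ℕ fun n => symMap k δ L e n

variable (k) in
/-- The average on words of all sizes. -/
def avTot (δ : (Fin N → ℕ) →+ D) (L : Fin t → VObj D) (e : D) : Tot k δ L e →ₗ[k] Tot k δ L e :=
  DFinsupp.mapRange.linearMap fun n => av k δ L e n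

/-- The map given by the elements `κ c` on words of all sizes. -/
def genTot {t' : ℕ} (κ : Fin t' → Σ Y, Word δ L Y →₀ k) (e : D) :
    Tot k δ (fun c => (κ c).1) e →ₗ[k] Tot k δ L e :=
  DFinsupp.mapRange.linearMap fun n => genMap κ ⟨e, n⟩

theorem symTot_single (n : ℕ) (x : Word δ L ⟨e, n⟩ →₀ k) :
    symTot k δ L e (DFinsupp.single n x) = symMap k δ L e n x := by
  simp [symTot]

theorem avTot_single (n : ℕ) (x : Word δ L ⟨e, n⟩ →₀ k) :
    avTot k δ L e (DFinsupp.single n x) = DFinsupp.single n (av k δ L e n x) := by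
  simp [avTot]

theorem genTot_single {t' : ℕ} (κ : Fin t' → Σ Y, Word δ L Y →₀ k) (n : ℕ)
    (x : Word δ (fun c => (κ c).1) ⟨e, n⟩ →₀ k) :
    genTot κ e (DFinsupp.single n x) = DFinsupp.single n (genMap κ _ x) := by
  simp [genTot]

theorem genTot_apply {t' : ℕ} (κ : Fin t' → Σ Y, Word δ L Y →₀ k)
    (x : Tot k δ (fun c => (κ c).1) e) (n : ℕ) : genTot κ e x n = genMap κ ⟨e, n⟩ (x n) :=
  DFinsupp.mapRange_apply _ (fun _ => map_zero _) _ _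

theorem avTot_apply (x : Tot k δ L e) (n : ℕ) : avTot k δ L e x n = av k δ L e n (x n) :=
  DFinsupp.mapRange_apply _ (fun _ => map_zero _) _ _

theorem symTot_avTot [CharZero k] (x : Tot k δ L e) :
    symTot k δ L e (avTot k δ L e x) = symTot k δ L e x := by
  have : symTot k δ L e ∘ₗ avTot k δ L e = symTot k δ L e := by
    refine DFinsupp.lhom_ext fun n x => ?_
    rw [LinearMap.comp_apply, avTot_single, symTot_single, symTot_single, symMap_av]
  exact LinearMap.congr_fun this x

theorem genTot_avTot {t' : ℕ} (κ : Fin t' → Σ Y, Word δ L Y →₀ k)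
    (x : Tot k δ (fun c => (κ c).1) e) :
    genTot κ e (avTot k δ _ e x) = avTot k δ L e (genTot κ e x) := by
  refine DFinsupp.ext fun n => ?_
  rw [genTot_apply, avTot_apply, avTot_apply, genTot_apply, genMap_av]

/-- The average factors through the symmetrization. -/
theorem avTot_eq_zero (x : Tot k δ L e) (hx : symTot k δ L e x = 0) : avTot k δ L e x = 0 := by
  classical
  let B := Finsupp.basis fun _ : Gen δ L e => MvPolynomial.basisMonomials (MonOf δ e) k
  let P : (Σ _ : Gen δ L e, (MonOf δ e →₀ ℕ)) → (Σ n, Word δ L ⟨e, n⟩) → Prop :=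
    fun s a => a.2.restr = s.1 ∧ a.2.2.exps = s.2
  -- A factorization of `avTot` through `symTot`: a basis element goes to the average of any word
  -- above it. Such words are conjugate under permutations, so the choice is harmless. The `else`
  -- branch is never reached on the image of a word.
  let H : (Σ _ : Gen δ L e, (MonOf δ e →₀ ℕ)) → Tot k δ L e := fun s =>
    if h : ∃ a, P s a then DFinsupp.single h.choose.1 (av k δ L e _ (Finsupp.single h.choose.2 1))
    else 0
  have hH : ∀ (n : ℕ) (p : Word δ L ⟨e, n⟩),
      H ⟨p.restr, p.2.exps⟩ = DFinsupp.single n (av k δ L e n (Finsupp.single p 1)) := by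
    intro n p
    have hex : ∃ a, P ⟨p.restr, p.2.exps⟩ a := ⟨⟨n, p⟩, rfl, rfl⟩
    simp only [H, dif_pos hex]
    have hspec := hex.choose_spec
    generalize hex.choose = a at hspec
    obtain ⟨m, b', w'⟩ := a
    obtain ⟨b, w⟩ := p
    obtain ⟨h1, h2⟩ := hspec
    obtain rfl : b' = b := congrArg Sigma.fst h1
    have h3 : ∀ i, w.mon (w.emb i) = w'.mon (w'.emb i) := fun i =>
      (congrArg Subtype.val (congrFun (eq_of_heq (Sigma.mk.inj h1).2) i)).symm
    change w'.exps = w.exps at h2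
    -- The size of a word is the number of its marks plus the degree of its exponent.
    obtain rfl : m = n := by
      rw [← w'.size_add_degree_exps, ← w.size_add_degree_exps, h2]
    obtain ⟨g, rfl⟩ := VHom.exists_perm_comp_eq w w' h3 h2.symm
    have := av_pushMap_perm (k := k) g (Finsupp.single (⟨b', w⟩ : Word δ L ⟨e, m⟩) 1)
    rw [pushMap_single] at this
    exact congrArg _ this
  have hcomp : B.constr k H ∘ₗ symTot k δ L e = avTot k δ L e := by
    refine DFinsupp.lhom_ext' fun n => ?_
    ext p : 2
    simp only [LinearMap.comp_apply, Finsupp.lsingle_apply, DFinsupp.lsingle_apply, symTot_single,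
      avTot_single, symMap_single]
    have : Finsupp.single p.restr (MvPolynomial.monomial p.2.exps (1 : k)) =
        B ⟨p.restr, p.2.exps⟩ := by
      simp [B]
    rw [this, Module.Basis.constr_basis, hH]
  rw [← hcomp, LinearMap.comp_apply, hx, map_zero]

/-! #### The differential -/

/-- The word consisting of the marked monomials only. -/
def Gen.word (γ : Gen δ L e) : Word δ L ⟨e, (L γ.1).size⟩ :=
  ⟨γ.1, { emb := id
          mon := fun i => (γ.2 i).1
          inj := Function.injective_id
          deg_emb := fun i => (γ.2 i).2
          deg_of_notMem := fun j hj => absurd ⟨j, rfl⟩ hj }⟩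

theorem Gen.restr_word (γ : Gen δ L e) : γ.word.restr = γ := rfl

theorem Gen.exps_word (γ : Gen δ L e) : γ.word.2.exps = 0 :=
  Finset.sum_eq_zero fun j _ => dif_pos ⟨j, rfl⟩

open Classical in
/-- The morphism inserting the unmarked monomials of a word. -/
def VHom.unmarked (w : VHom δ X ⟨e, n⟩) : VHom δ ⟨e, X.size⟩ ⟨e, n⟩ where
  emb := w.emb
  mon j := if j ∈ Set.range w.emb then 0 else w.mon j
  inj := w.inj
  deg_emb i := by
    rw [if_pos ⟨i, rfl⟩]
    simp
  deg_of_notMem j hj := by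
    rw [if_neg hj]
    exact w.deg_of_notMem j hj

theorem VHom.unmarked_mon_emb (w : VHom δ X ⟨e, n⟩) (i : Fin X.size) :
    w.unmarked.mon (w.unmarked.emb i) = 0 :=
  if_pos ⟨i, rfl⟩

theorem VHom.exps_unmarked (w : VHom δ X ⟨e, n⟩) : w.unmarked.exps = w.exps := by
  refine Finset.sum_congr rfl fun j _ => ?_
  by_cases hj : j ∈ Set.range w.emb
  · obtain ⟨i, rfl⟩ := hj
    exact (expAt_emb w.unmarked i).trans (expAt_emb w i).symm
  · refine (expAt_of_notMem w.unmarked j hj).trans ((expAt_of_notMem w j hj).trans ?_).symm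
    congr 2
    exact (if_neg hj).symm

theorem Word.push_unmarked (p : Word δ L ⟨e, n⟩) : p.restr.word.push p.2.unmarked = p := by
  refine congrArg (Sigma.mk p.1) (VHom.ext rfl (funext fun j => ?_))
  by_cases hj : j ∈ Set.range p.2.emb
  · obtain ⟨i, rfl⟩ := hj
    refine (VHom.comp_mon_emb p.2.unmarked _ i).trans ?_
    rw [VHom.unmarked_mon_emb, zero_add]
    rfl
  · exact (VHom.comp_mon_of_notMem p.2.unmarked _ j hj).trans (if_neg hj)

/-- The map of free modules over the polynomial ring induced by the elements `κ c`. -/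
def symGenMap {t' : ℕ} (κ : Fin t' → Σ Y, Word δ L Y →₀ k) (e : D) :
    (Gen δ (fun c => (κ c).1) e →₀ MvPolynomial (MonOf δ e) k) →ₗ[MvPolynomial (MonOf δ e) k]
      (Gen δ L e →₀ MvPolynomial (MonOf δ e) k) :=
  Finsupp.linearCombination _ fun γ => symMap k δ L e _ (genMap κ _ (Finsupp.single γ.word 1))

/-- Every word arises from its marked part by inserting unmarked monomials. After symmetrization the
insertion is multiplication by a monomial, so the induced map is linear over the polynomial ring. -/
theorem symMap_genMap {t' : ℕ} (κ : Fin t' → Σ Y, Word δ L Y →₀ k)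
    (x : Word δ (fun c => (κ c).1) ⟨e, n⟩ →₀ k) :
    symMap k δ L e n (genMap κ _ x) = symGenMap κ e (symMap k δ _ e n x) := by
  have : symMap k δ L e n ∘ₗ genMap κ _ =
      (symGenMap κ e).restrictScalars k ∘ₗ symMap k δ _ e n := by
    ext p : 2
    simp only [LinearMap.comp_apply, Finsupp.lsingle_apply, symMap_single,
      LinearMap.restrictScalars_apply]
    have h := pushMap_single k p.2.unmarked p.restr.word 1
    rw [Word.push_unmarked] at h
    rw [← h, genMap_pushMap]
    refine (symMap_pushMap _ p.2.unmarked_mon_emb _).trans ?_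
    rw [VHom.exps_unmarked, symGenMap, Finsupp.linearCombination_single]
    rfl
  exact LinearMap.congr_fun this x

theorem symTot_genTot {t' : ℕ} (κ : Fin t' → Σ Y, Word δ L Y →₀ k)
    (x : Tot k δ (fun c => (κ c).1) e) :
    symTot k δ L e (genTot κ e x) = symGenMap κ e (symTot k δ _ e x) := by
  have : symTot k δ L e ∘ₗ genTot κ e = (symGenMap κ e).restrictScalars k ∘ₗ symTot k δ _ e := by
    refine DFinsupp.lhom_ext fun n x => ?_
    simp only [LinearMap.comp_apply, genTot_single, symTot_single, symMap_genMap,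
      LinearMap.restrictScalars_apply]
  exact LinearMap.congr_fun this x

/-- The morphism adding a position with a given monomial. -/
def VHom.snoc (α : MonOf δ e) (n : ℕ) : VHom δ ⟨e, n⟩ ⟨e, n + 1⟩ where
  emb := Fin.castSucc
  mon := Fin.lastCases α.1 fun _ => 0
  inj := Fin.castSucc_injective n
  deg_emb i := by simp
  deg_of_notMem j hj := by
    refine Fin.lastCases (fun _ => ?_) (fun i hi => absurd ⟨i, rfl⟩ hi) j hj
    rw [Fin.lastCases_last]
    exact α.2

theorem VHom.exps_snoc (α : MonOf δ e) (n : ℕ) : (snoc α n).exps = Finsupp.single α 1 := by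
  rw [exps, Fin.sum_univ_castSucc, Finset.sum_eq_zero, zero_add, expAt_of_notMem]
  · congr 1
    exact Subtype.ext (Fin.lastCases_last (motive := fun _ => Fin N → ℕ))
  · rintro ⟨i, hi⟩
    exact absurd hi (Fin.castSucc_lt_last i).ne
  · exact fun i _ => expAt_emb (snoc α n) i

/-- The image contains the basis, through fully marked words, and is stable under each variable,
through adding one position. -/
theorem symTot_surjective : Function.Surjective (symTot k δ L e) := by
  rw [← LinearMap.range_eq_top, eq_top_iff]
  have hX : ∀ (α : MonOf δ e), ∀ y ∈ LinearMap.range (symTot k δ L e),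
      (MvPolynomial.X α : MvPolynomial (MonOf δ e) k) • y ∈ LinearMap.range (symTot k δ L e) := by
    rintro α _ ⟨x, rfl⟩
    induction x using DFinsupp.induction with
    | h0 => simp
    | ha n x f _ _ h =>
      rw [map_add, smul_add, symTot_single]
      refine add_mem ⟨DFinsupp.single (n + 1) (pushMap k (VHom.snoc α n) x), ?_⟩ h
      rw [symTot_single, symMap_pushMap, VHom.exps_snoc]
      · rfl
      · exact fun i => Fin.lastCases_castSucc (motive := fun _ => Fin N → ℕ) i
  rintro y -
  induction y using Finsupp.induction_linear with
  | zero => exact zero_mem _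
  | add f g hf hg => exact add_mem hf hg
  | single γ a =>
    induction a using MvPolynomial.induction_on with
    | C c =>
      refine ⟨c • (DFinsupp.single (L γ.1).size (Finsupp.single γ.word 1) : Tot k δ L e), ?_⟩
      rw [map_smul, symTot_single, symMap_single, Gen.restr_word, Gen.exps_word,
        Finsupp.smul_single]
      congr 1
      simp [MvPolynomial.smul_eq_C_mul]
    | add p q hp hq =>
      rw [Finsupp.single_add]
      exact add_mem hp hq
    | mul_X p α hp =>
      have := hX α _ hp
      rwa [Finsupp.smul_single, smul_eq_mul, mul_comm] at this

/-- The image of a family under symmetrization. -/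
def SubFamily.sym (𝒦 : SubFamily k δ) (e : D) :
    Set (Gen δ 𝒦.L e →₀ MvPolynomial (MonOf δ e) k) :=
  {y | ∃ x : Tot k δ 𝒦.L e, (∀ n, x n ∈ 𝒦.K ⟨e, n⟩) ∧ symTot k δ 𝒦.L e x = y}

theorem SubFamily.Generates.range_symGenMap {𝒦 : SubFamily k δ} {t' : ℕ}
    {κ : Fin t' → Σ Y, Word δ 𝒦.L Y →₀ k} (h : 𝒦.Generates κ) (e : D) :
    Set.range (symGenMap κ e) = 𝒦.sym e := by
  classical
  ext y
  constructor
  · rintro ⟨z, rfl⟩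
    obtain ⟨z, rfl⟩ := symTot_surjective z
    refine ⟨genTot κ e z, fun n => ?_, symTot_genTot κ z⟩
    rw [← h.range_genMap]
    exact ⟨z n, rfl⟩
  · rintro ⟨x, hx, rfl⟩
    have hz : ∀ n, ∃ z, genMap κ ⟨e, n⟩ z = x n := fun n => (h.range_genMap ⟨e, n⟩).ge (hx n)
    choose z hz using hz
    let w : Tot k δ (fun c => (κ c).1) e := DFinsupp.mk x.support fun n => z n
    have hw : genTot κ e w = x := by
      refine DFinsupp.ext fun n => ?_
      rw [genTot_apply, DFinsupp.mk_apply]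
      split_ifs with hn
      · exact hz n
      · rw [map_zero, DFinsupp.notMem_support_iff.1 hn]
    exact ⟨symTot k δ _ e w, by rw [← symTot_genTot, hw]⟩

/-- Exactness survives symmetrization: if the image of `z` symmetrizes to zero, its average
vanishes, so the average of `z` lies in the kernel family, and it has the same symmetrization as
`z`. -/
theorem symGenMap_eq_zero_iff [CharZero k] {t' : ℕ} (κ : Fin t' → Σ Y, Word δ L Y →₀ k) (e : D)
    (y : Gen δ (fun c => (κ c).1) e →₀ MvPolynomial (MonOf δ e) k) :
    symGenMap κ e y = 0 ↔ y ∈ (kerFamily κ).sym e := by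
  constructor
  · intro hy
    obtain ⟨z, rfl⟩ := symTot_surjective y
    refine ⟨avTot k δ _ e z, fun n => ?_, symTot_avTot z⟩
    rw [← symTot_genTot] at hy
    have := avTot_eq_zero _ hy
    rw [← genTot_avTot] at this
    exact DFunLike.congr_fun this n
  · have key : ∀ x : Tot k δ (fun c => (κ c).1) e, (∀ n, genMap κ ⟨e, n⟩ (x n) = 0) →
        symGenMap κ e (symTot k δ _ e x) = 0 := by
      intro x hx
      have h0 : genTot κ e x = 0 := DFinsupp.ext fun n => (genTot_apply κ x n).trans (hx n)
      rw [← symTot_genTot, h0, map_zero]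
    rintro ⟨x, hx, rfl⟩
    exact key x hx

variable (k) in
/-- The degree `n` part of the free module over the polynomial ring. -/
abbrev genDeg (δ : (Fin N → ℕ) →+ D) (L : Fin t → VObj D) (e : D) (n : ℕ) :
    AddSubgroup (Gen δ L e →₀ MvPolynomial (MonOf δ e) k) :=
  freeDeg (fun c => (MvPolynomial.homogeneousSubmodule (MonOf δ e) k c).toAddSubgroup)
    (fun γ => (L γ.1).size) n

theorem symMap_mem_genDeg (x : Word δ L ⟨e, n⟩ →₀ k) : symMap k δ L e n x ∈ genDeg k δ L e n := by
  rw [symMap, Finsupp.linearCombination_apply]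
  refine AddSubgroup.sum_mem _ fun p _ => AddSubgroup.subset_closure
    ⟨p.restr, p.2.exps.degree, x p • MvPolynomial.monomial p.2.exps 1, ?_, ?_, ?_⟩
  · exact Submodule.smul_mem _ _ (MvPolynomial.isHomogeneous_monomial _ rfl)
  · rw [add_comm]
    exact p.2.size_add_degree_exps
  · exact (Finsupp.smul_single _ _ _).symm

theorem symGenMap_single_mem {t' : ℕ} (κ : Fin t' → Σ Y, Word δ L Y →₀ k) (e : D)
    (γ : Gen δ (fun c => (κ c).1) e) :
    symGenMap κ e (Finsupp.single γ 1) ∈ genDeg k δ L e (κ γ.1).1.size := by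
  rw [symGenMap, Finsupp.linearCombination_single, one_smul]
  exact symMap_mem_genDeg _

end Symmetrization

/-! ### Secant ideals as kernels of power sum maps -/

section PowerSum

universe u v

variable {k : Type u} [Field k]

/-- The homomorphism `Sym(V) → E[X_i]` with `v ↦ ∑ᵢ ιᵢ(v) Xᵢ`. -/
def powerMap {V B E σ : Type*} [AddCommGroup V] [Module k V] [CommRing B] [Algebra k B]
    [CommRing E] [Algebra k E] [Fintype σ] (ι : σ → B →ₐ[k] E) (f : V →ₗ[k] B) :
    SymmetricAlgebra k V →ₐ[k] MvPolynomial σ E :=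
  SymmetricAlgebra.lift (∑ i, ((MvPolynomial.monomial (Finsupp.single i 1)).restrictScalars k ∘ₗ
    (ι i).toLinearMap ∘ₗ f))

theorem powerMap_ι {V B E σ : Type*} [AddCommGroup V] [Module k V] [CommRing B] [Algebra k B]
    [CommRing E] [Algebra k E] [Fintype σ] (ι : σ → B →ₐ[k] E) (f : V →ₗ[k] B) (v : V) :
    powerMap ι f (SymmetricAlgebra.ι k V v) =
      ∑ i, MvPolynomial.monomial (Finsupp.single i 1) (ι i (f v)) := by
  simp [powerMap]

/-! ### Tensor products of polynomial rings. -/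

section TensorMvPolynomial

variable (k) (σ τ : Type*) (E F : Type*) [CommRing E] [CommRing F] [Algebra k E] [Algebra k F]

/-- The homomorphism `E[σ] ⊗ F[τ] → (E ⊗ F)[σ ⊕ τ]`. -/
def tensorMvPolynomial :
    MvPolynomial σ E ⊗[k] MvPolynomial τ F →ₐ[k] MvPolynomial (σ ⊕ τ) (E ⊗[k] F) :=
  Algebra.TensorProduct.lift
    (((MvPolynomial.rename Sum.inl).restrictScalars k).comp
      (MvPolynomial.mapAlgHom Algebra.TensorProduct.includeLeft))
    (((MvPolynomial.rename Sum.inr).restrictScalars k).comp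
      (MvPolynomial.mapAlgHom Algebra.TensorProduct.includeRight))
    fun _ _ => mul_comm _ _

theorem tensorMvPolynomial_tmul (a : MvPolynomial σ E) (b : MvPolynomial τ F) :
    tensorMvPolynomial k σ τ E F (a ⊗ₜ b) =
      MvPolynomial.rename Sum.inl (MvPolynomial.map
        (Algebra.TensorProduct.includeLeft : E →ₐ[k] E ⊗[k] F).toRingHom a) *
      MvPolynomial.rename Sum.inr (MvPolynomial.map
        (Algebra.TensorProduct.includeRight : F →ₐ[k] E ⊗[k] F).toRingHom b) := by
  exact Algebra.TensorProduct.lift_tmul _ _ _ _ _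

theorem tensorMvPolynomial_injective : Function.Injective (tensorMvPolynomial k σ τ E F) := by
  -- A left inverse, sending each variable back to its own factor.
  let Λ : MvPolynomial (σ ⊕ τ) (E ⊗[k] F) →+* MvPolynomial σ E ⊗[k] MvPolynomial τ F :=
    MvPolynomial.eval₂Hom (Algebra.TensorProduct.map (Algebra.ofId E (MvPolynomial σ E) |>.restrictScalars k)
      (Algebra.ofId F (MvPolynomial τ F) |>.restrictScalars k)).toRingHom
      (Sum.elim (fun i => MvPolynomial.X i ⊗ₜ 1) fun j => 1 ⊗ₜ MvPolynomial.X j)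
  have h1 : ∀ a : MvPolynomial σ E, Λ (tensorMvPolynomial k σ τ E F (a ⊗ₜ 1)) = a ⊗ₜ 1 := by
    intro a
    rw [tensorMvPolynomial_tmul, map_one, map_one, mul_one]
    induction a using MvPolynomial.induction_on with
    | C c => simp [Λ, Algebra.ofId_apply, MvPolynomial.algebraMap_eq]
    | add p q hp hq => simp only [map_add, hp, hq, TensorProduct.add_tmul]
    | mul_X p i hp =>
      rw [map_mul, map_mul, map_mul, hp]
      simp [Λ]
  have h2 : ∀ a : MvPolynomial τ F, Λ (tensorMvPolynomial k σ τ E F (1 ⊗ₜ a)) = 1 ⊗ₜ a := by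
    intro a
    rw [tensorMvPolynomial_tmul, map_one, map_one, one_mul]
    induction a using MvPolynomial.induction_on with
    | C c => simp [Λ, Algebra.ofId_apply, MvPolynomial.algebraMap_eq]
    | add p q hp hq => simp only [map_add, hp, hq, TensorProduct.tmul_add]
    | mul_X p i hp =>
      rw [map_mul, map_mul, map_mul, hp]
      simp [Λ]
  refine Function.LeftInverse.injective (g := Λ) fun z => ?_
  induction z with
  | zero => simp
  | add x y hx hy => rw [map_add, map_add, hx, hy]
  | tmul a b =>
    have : a ⊗ₜ[k] b = (a ⊗ₜ 1) * (1 ⊗ₜ b) := by simp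
    rw [this, map_mul, map_mul, h1, h2]

end TensorMvPolynomial

/-- Over a field the tensor product of the injections `Sym(V)/I → A` and `Sym(V)/J → C` is
injective, so the quotients may be replaced by `A` and `C`. -/
theorem comulQuot_eq_zero_iff {V A C : Type*} [AddCommGroup V] [Module k V] [CommRing A] [CommRing C]
    [Algebra k A] [Algebra k C] (f : SymmetricAlgebra k V →ₐ[k] A)
    (g : SymmetricAlgebra k V →ₐ[k] C) {I J : Ideal (SymmetricAlgebra k V)}
    (hI : I = RingHom.ker f) (hJ : J = RingHom.ker g) (x : SymmetricAlgebra k V) :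
    comulQuot I J x = 0 ↔
      Algebra.TensorProduct.map f g (Bialgebra.comulAlgHom k (SymmetricAlgebra k V) x) = 0 := by
  subst hI hJ
  have h : Algebra.TensorProduct.map f g =
      (Algebra.TensorProduct.map (Ideal.kerLiftAlg f) (Ideal.kerLiftAlg g)).comp
        (Algebra.TensorProduct.map (Ideal.Quotient.mkₐ k (RingHom.ker f))
          (Ideal.Quotient.mkₐ k (RingHom.ker g))) := by
    rw [← Algebra.TensorProduct.map_comp]
    rfl
  have hinj : Function.Injective
      (Algebra.TensorProduct.map (Ideal.kerLiftAlg f) (Ideal.kerLiftAlg g)) :=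
    TensorProduct.map_injective_of_flat_flat (Ideal.kerLiftAlg f).toLinearMap
      (Ideal.kerLiftAlg g).toLinearMap (Ideal.kerLiftAlg_injective f)
      (Ideal.kerLiftAlg_injective g)
  rw [h]
  exact (map_eq_zero_iff _ hinj).symm

variable {B : Type v} [CommRing B] [Algebra k B] {ℓ : ℕ}

/-- Comultiplication sends `v` to `v ⊗ 1 + 1 ⊗ v`, so each step of the induction adds one tensor
factor `B` and one variable. The data `σ`, `E`, `ι` are independent of `d`, which the uniform bound
needs. -/
theorem exists_secantIdeal_eq_ker (𝓑 : (Fin ℓ → ℕ) → Submodule k B) (r : ℕ) :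
    ∃ (σ : Type) (_ : Fintype σ) (E : Type v) (_ : CommRing E) (_ : Algebra k E)
      (ι : σ → B →ₐ[k] E), ∀ d, ∀ x, x ∈ secantIdeal 𝓑 d (r + 1) ↔
        powerMap ι (𝓑 d).subtype x = 0 := by
  have hone : ∀ d, ∀ x, mulMap 𝓑 d x = 0 ↔
      powerMap (fun _ : Unit => AlgHom.id k B) (𝓑 d).subtype x = 0 := by
    intro d x
    have h : mulMap 𝓑 d = ((MvPolynomial.uniqueAlgEquiv B Unit).toAlgHom.restrictScalars k).comp
        (powerMap (fun _ : Unit => AlgHom.id k B) (𝓑 d).subtype) := by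
      ext v
      simp [mulMap, powerMap_ι, MvPolynomial.monomial_eq, Polynomial.C_mul_X_eq_monomial]
    rw [h]
    exact map_eq_zero_iff _ (MvPolynomial.uniqueAlgEquiv B Unit).injective
  induction r with
  | zero => exact ⟨Unit, inferInstance, B, inferInstance, inferInstance, fun _ => AlgHom.id k B, hone⟩
  | succ r ih =>
    obtain ⟨σ, _, E, _, _, ι, h⟩ := ih
    refine ⟨Unit ⊕ σ, inferInstance, B ⊗[k] E, inferInstance, inferInstance,
      Sum.elim (fun _ => Algebra.TensorProduct.includeLeft)
        fun i => Algebra.TensorProduct.includeRight.comp (ι i), fun d x => ?_⟩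
    have h1 : RingHom.ker (mulMap 𝓑 d) =
        RingHom.ker (powerMap (fun _ : Unit => AlgHom.id k B) (𝓑 d).subtype) :=
      Ideal.ext fun x => hone d x
    have h2 : secantIdeal 𝓑 d (r + 1) = RingHom.ker (powerMap ι (𝓑 d).subtype) :=
      Ideal.ext fun x => h d x
    rw [secantIdeal, RingHom.mem_ker, comulQuot_eq_zero_iff _ _ h1 h2,
      ← map_eq_zero_iff _ (tensorMvPolynomial_injective k Unit σ B E)]
    have h3 : (tensorMvPolynomial k Unit σ B E).comp ((Algebra.TensorProduct.map
        (powerMap (fun _ : Unit => AlgHom.id k B) (𝓑 d).subtype)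
        (powerMap ι (𝓑 d).subtype)).comp (Bialgebra.comulAlgHom k _)) =
        powerMap (Sum.elim (fun _ => Algebra.TensorProduct.includeLeft)
          fun i => Algebra.TensorProduct.includeRight.comp (ι i)) (𝓑 d).subtype := by
      ext v
      simp [powerMap_ι, tensorMvPolynomial_tmul, MvPolynomial.rename_monomial,
        MvPolynomial.map_monomial]
    rw [← h3]
    rfl

end PowerSum

/-! ### The family of kernels defining the secant ideals -/

section Base

variable {k : Type*} [Field k] {N : ℕ} {D : Type*} [AddCommMonoid D] {δ : (Fin N → ℕ) →+ D}
  {Y Z : VObj D} {B : Type*} [CommRing B] [Algebra k B]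

/-- The monomials in the elements `x i`. -/
def monEval (x : Fin N → B) (α : Fin N → ℕ) : B := ∏ i, x i ^ α i

theorem monEval_zero (x : Fin N → B) : monEval x 0 = 1 := by
  simp [monEval]

theorem monEval_add (x : Fin N → B) (α β : Fin N → ℕ) :
    monEval x (α + β) = monEval x α * monEval x β := by
  simp [monEval, pow_add, Finset.prod_mul_distrib]

variable (D) in
/-- The object with no positions in degree zero. -/
abbrev baseObj (_ : Fin 1) : VObj D := ⟨0, 0⟩

variable {σ : Type*} {E : Type*} [CommRing E] [Algebra k E]

/-- The product of the monomials of a word, distributed according to `φ`. -/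
def evMap (δ : (Fin N → ℕ) →+ D) (x : Fin N → B) (ι : σ → B →ₐ[k] E) {Y : VObj D}
    (φ : Fin Y.size → σ) : (Word δ (baseObj D) Y →₀ k) →ₗ[k] E :=
  Finsupp.linearCombination k fun p => ∏ j, ι (φ j) (monEval x (p.2.mon j))

/-- A push restricts the distribution along the embedding and multiplies by a factor depending only
on `ψ`. This makes `baseFamily` closed under morphisms. -/
theorem evMap_pushMap (x : Fin N → B) (ι : σ → B →ₐ[k] E) (ψ : VHom δ Y Z)
    (φ : Fin Z.size → σ) (z : Word δ (baseObj D) Y →₀ k) : evMap δ x ι φ (pushMap k ψ z) =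
      (∏ j, ι (φ j) (monEval x (ψ.mon j))) * evMap δ x ι (φ ∘ ψ.emb) z := by
  have : evMap δ x ι φ ∘ₗ pushMap k ψ = LinearMap.mulLeft k
      (∏ j, ι (φ j) (monEval x (ψ.mon j))) ∘ₗ evMap δ x ι (φ ∘ ψ.emb) := by
    ext p : 2
    simp only [LinearMap.comp_apply, Finsupp.lsingle_apply, pushMap_single, evMap,
      Finsupp.linearCombination_single, one_smul, LinearMap.mulLeft_apply]
    have h : ∀ j, ι (φ j) (monEval x ((p.push ψ).2.mon j)) = ι (φ j) (monEval x (ψ.mon j)) *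
        Function.extend ψ.emb (fun i => ι (φ (ψ.emb i)) (monEval x (p.2.mon i))) 1 j := by
      intro j
      by_cases hj : j ∈ Set.range ψ.emb
      · obtain ⟨i, rfl⟩ := hj
        rw [ψ.inj.extend_apply, ← map_mul, ← monEval_add]
        exact congrArg _ (congrArg _ (ψ.comp_mon_emb p.2 i))
      · rw [Function.extend_apply' _ _ _ hj, Pi.one_apply, mul_one]
        exact congrArg _ (congrArg _ (ψ.comp_mon_of_notMem p.2 j hj))
    rw [Finset.prod_congr rfl fun j _ => h j, Finset.prod_mul_distrib]
    congr 1
    exact (Fintype.prod_of_injective ψ.emb ψ.inj _ (Function.extend ψ.emb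
      (fun i => ι (φ (ψ.emb i)) (monEval x (p.2.mon i))) 1)
      (fun j hj => Function.extend_apply' _ _ _ hj)
      fun i => (ψ.inj.extend_apply _ _ _).symm).symm
  exact LinearMap.congr_fun this z

/-- The linear combinations of words which vanish under all distributed multiplication maps. -/
def baseFamily (δ : (Fin N → ℕ) →+ D) (x : Fin N → B) (ι : σ → B →ₐ[k] E) : SubFamily k δ where
  t := 1
  L := baseObj D
  K Y :=
    { carrier := {z | ∀ φ : Fin Y.size → σ, evMap δ x ι φ z = 0}
      zero_mem' := fun φ => map_zero _
      add_mem' := fun ha hb φ => by rw [map_add, ha φ, hb φ, add_zero]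
      smul_mem' := fun c z hz φ => by rw [map_smul, hz φ, smul_zero] }
  closed ψ z hz φ := by
    have h : evMap δ x ι (φ ∘ ψ.emb) z = 0 := hz (φ ∘ ψ.emb)
    rw [evMap_pushMap, h, mul_zero]

/-- The exponent of the monomial in which a distribution contributes. -/
def contentOf {n : ℕ} (φ : Fin n → σ) : σ →₀ ℕ := ∑ j, Finsupp.single (φ j) 1

theorem degree_contentOf {n : ℕ} (φ : Fin n → σ) : (contentOf φ).degree = n := by
  simp [contentOf]

theorem exists_perm_of_contentOf_eq {n : ℕ} (φ φ' : Fin n → σ) (h : contentOf φ = contentOf φ') :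
    ∃ g : Equiv.Perm (Fin n), φ' ∘ g = φ := by
  classical
  obtain ⟨g, hg⟩ := exists_perm_of_card_fiber_eq φ φ' fun x => by
    have := DFunLike.congr_fun h x
    simpa only [contentOf, Finsupp.coe_finsetSum, Finset.sum_apply, Finsupp.single_apply]
      using this
  exact ⟨g, funext hg⟩

theorem prod_monomial {n : ℕ} (s : Fin n → σ →₀ ℕ) (a : Fin n → E) :
    ∏ j, MvPolynomial.monomial (s j) (a j) = MvPolynomial.monomial (∑ j, s j) (∏ j, a j) := by
  induction n with
  | zero => simp
  | succ n ih =>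
    rw [Fin.prod_univ_succ, ih, MvPolynomial.monomial_mul, ← Fin.sum_univ_succ,
      ← Fin.prod_univ_succ]

variable [Fintype σ] {e : D} {n : ℕ}

/-- The homomorphism from the polynomial ring on the monomials of degree `e` with
`α ↦ ∑ᵢ ιᵢ(x^α) Xᵢ`. -/
def monPower (δ : (Fin N → ℕ) →+ D) (x : Fin N → B) (ι : σ → B →ₐ[k] E) (e : D) :
    MvPolynomial (MonOf δ e) k →ₐ[k] MvPolynomial σ E :=
  MvPolynomial.aeval fun α => ∑ i, MvPolynomial.monomial (Finsupp.single i 1)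
    (ι i (monEval x α.1))

/-- The augmentation on the free module over the polynomial ring. -/
def augMap (δ : (Fin N → ℕ) →+ D) (x : Fin N → B) (ι : σ → B →ₐ[k] E) (e : D) :
    (Gen δ (baseObj D) e →₀ MvPolynomial (MonOf δ e) k) →ₗ[k] MvPolynomial σ E :=
  Finsupp.lsum k fun _ => (monPower δ x ι e).toLinearMap

theorem VHom.monomial_exps_of_size_eq_zero {X : VObj D} (hX : X.size = 0)
    (w : VHom δ X ⟨e, n⟩) : (MvPolynomial.monomial w.exps 1 : MvPolynomial (MonOf δ e) k) =
      ∏ j, MvPolynomial.X ⟨w.mon j, w.deg_of_notMem j (by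
        rintro ⟨i, -⟩
        exact absurd i.2 (by omega))⟩ := by
  have h : ∀ j : Fin n, j ∉ Set.range w.emb := by
    rintro j ⟨i, -⟩
    exact absurd i.2 (by omega)
  rw [exps, Finset.sum_congr rfl fun j _ => w.expAt_of_notMem j (h j)]
  have := prod_monomial (E := k) (fun j => Finsupp.single
    (⟨w.mon j, w.deg_of_notMem j (h j)⟩ : MonOf δ e) 1) 1
  simp only [Pi.one_apply, Finset.prod_const_one] at this
  exact this.symm

/-- A product of `n` sums over `σ` expands into one term for each distribution `φ`. -/
theorem augMap_symMap (x : Fin N → B) (ι : σ → B →ₐ[k] E) (z : Word δ (baseObj D) ⟨e, n⟩ →₀ k) :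
    augMap δ x ι e (symMap k δ _ e n z) =
      ∑ φ : Fin n → σ, MvPolynomial.monomial (contentOf φ) (evMap δ x ι (Y := ⟨e, n⟩) φ z) := by
  classical
  have : augMap δ x ι e ∘ₗ symMap k δ _ e n = ∑ φ : Fin n → σ,
      (MvPolynomial.monomial (contentOf φ)).restrictScalars k ∘ₗ
        evMap δ x ι (Y := ⟨e, n⟩) φ := by
    ext p : 2
    rw [LinearMap.comp_apply, LinearMap.comp_apply, LinearMap.comp_apply, Finsupp.lsingle_apply,
      symMap_single, augMap, Finsupp.lsum_single, p.2.monomial_exps_of_size_eq_zero rfl,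
      AlgHom.toLinearMap_apply, map_prod, LinearMap.sum_apply]
    simp only [monPower, MvPolynomial.aeval_X, LinearMap.comp_apply,
      LinearMap.restrictScalars_apply, evMap, Finsupp.linearCombination_single, one_smul]
    rw [Finset.prod_univ_sum, Fintype.piFinset_univ]
    exact Finset.sum_congr rfl fun φ _ => prod_monomial _ _
  refine (LinearMap.congr_fun this z).trans ?_
  simp

theorem coeff_augMap_symTot [DecidableEq σ] (x : Fin N → B) (ι : σ → B →ₐ[k] E)
    (z : Tot k δ (baseObj D) e) (μ : σ →₀ ℕ) (hμ : μ.degree = n) :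
    (augMap δ x ι e (symTot k δ _ e z)).coeff μ =
      ∑ φ : Fin n → σ, if contentOf φ = μ then evMap δ x ι (Y := ⟨e, n⟩) φ (z n) else 0 := by
  induction z using DFinsupp.induction with
  | h0 => simp
  | ha m a f _ _ h =>
    rw [map_add, map_add, MvPolynomial.coeff_add, h, symTot_single, augMap_symMap,
      MvPolynomial.coeff_sum]
    have h1 : ∀ φ : Fin n → σ, (if contentOf φ = μ then evMap δ x ι (Y := ⟨e, n⟩) φ
        ((DFinsupp.single m a + f : Tot k δ (baseObj D) e) n) else 0) =
        (if contentOf φ = μ then evMap δ x ι (Y := ⟨e, n⟩) φ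
          ((DFinsupp.single m a : Tot k δ (baseObj D) e) n) else 0) +
        if contentOf φ = μ then evMap δ x ι (Y := ⟨e, n⟩) φ (f n) else 0 := by
      intro φ
      split_ifs
      · rw [DFinsupp.add_apply, map_add]
      · rw [add_zero]
    rw [Finset.sum_congr rfl fun φ _ => h1 φ, Finset.sum_add_distrib]
    congr 1
    by_cases hm : m = n
    · subst hm
      refine Finset.sum_congr rfl fun φ _ => ?_
      rw [MvPolynomial.coeff_monomial, DFinsupp.single_eq_same]
    · rw [Finset.sum_eq_zero, Finset.sum_eq_zero]
      · intro φ _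
        rw [DFinsupp.single_eq_of_ne (Ne.symm hm), map_zero, ite_self]
      · intro φ _
        rw [MvPolynomial.coeff_monomial, if_neg]
        rintro rfl
        rw [degree_contentOf] at hμ
        exact hm hμ

/-- A coefficient of the image is a sum over all distributions of given content. Permutations act
transitively on these, so on an averaged element the terms coincide and, in characteristic `0`, each
vanishes when the sum does. -/
theorem augMap_eq_zero_iff [CharZero k] (x : Fin N → B) (ι : σ → B →ₐ[k] E) (e : D)
    (y : Gen δ (baseObj D) e →₀ MvPolynomial (MonOf δ e) k) :
    augMap δ x ι e y = 0 ↔ y ∈ (baseFamily δ x ι).sym e := by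
  classical
  constructor
  · intro hy
    obtain ⟨z, rfl⟩ := symTot_surjective y
    refine ⟨avTot k δ _ e z, fun n φ => ?_, symTot_avTot z⟩
    rw [← symTot_avTot] at hy
    have h := coeff_augMap_symTot x ι (avTot k δ _ e z) (contentOf φ) (degree_contentOf φ)
    rw [hy, MvPolynomial.coeff_zero, avTot_apply] at h
    change evMap δ x ι (Y := ⟨e, n⟩) φ (avTot k δ _ e z n) = 0
    rw [avTot_apply]
    have h1 : ∀ φ' : Fin n → σ, (if contentOf φ' = contentOf φ then
        evMap δ x ι (Y := ⟨e, n⟩) φ' (av k δ _ e n (z n)) else 0) =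
        if contentOf φ' = contentOf φ then evMap δ x ι (Y := ⟨e, n⟩) φ (av k δ _ e n (z n))
          else 0 := by
      intro φ'
      split_ifs with hφ
      · obtain ⟨g, rfl⟩ := exists_perm_of_contentOf_eq φ' φ hφ
        have := evMap_pushMap x ι (VHom.perm δ e g) φ (av k δ _ e n (z n))
        rw [pushMap_perm_av] at this
        rw [this]
        simp [VHom.perm, monEval_zero]
      · rfl
    rw [Finset.sum_congr rfl fun φ' _ => h1 φ', ← Finset.sum_filter, Finset.sum_const,
      ← Nat.cast_smul_eq_nsmul k] at h
    refine (smul_eq_zero.1 h.symm).resolve_left ?_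
    rw [← ne_eq, Nat.cast_ne_zero]
    exact Finset.card_ne_zero_of_mem (Finset.mem_filter.2 ⟨Finset.mem_univ φ, rfl⟩)
  · have key : ∀ z : Tot k δ (baseObj D) e,
        (∀ n (φ : Fin n → σ), evMap δ x ι (Y := ⟨e, n⟩) φ (z n) = 0) →
        augMap δ x ι e (symTot k δ _ e z) = 0 := by
      intro z hz
      refine MvPolynomial.ext _ _ fun μ => ?_
      rw [coeff_augMap_symTot x ι z μ rfl, MvPolynomial.coeff_zero]
      exact Finset.sum_eq_zero fun φ _ => by rw [hz, ite_self]
    rintro ⟨z, hz, rfl⟩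
    exact key z hz

end Base

/-! ### Iterated syzygies -/

section Syzygies

variable {k : Type*} [Field k] {N : ℕ} {D : Type*} [AddCommMonoid D] {δ : (Fin N → ℕ) →+ D}

/-- The number of elements in a chosen finite generating family. -/
def SubFamily.numGens (𝒦 : SubFamily k δ) : ℕ := 𝒦.exists_generates.choose

/-- A chosen finite generating family. -/
def SubFamily.gens (𝒦 : SubFamily k δ) : Fin 𝒦.numGens → Σ Y, Word δ 𝒦.L Y →₀ k :=
  𝒦.exists_generates.choose_spec.choose

theorem SubFamily.generates_gens (𝒦 : SubFamily k δ) : 𝒦.Generates 𝒦.gens :=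
  𝒦.exists_generates.choose_spec.choose_spec

/-- The iterated syzygies of a family. -/
def SubFamily.syz (𝒦 : SubFamily k δ) : ℕ → SubFamily k δ
  | 0 => 𝒦
  | i + 1 => kerFamily (𝒦.syz i).gens

/-- A bound for the sizes of the sources. -/
def SubFamily.maxSize (𝒦 : SubFamily k δ) : ℕ := Finset.univ.sup fun b => (𝒦.L b).size

theorem SubFamily.size_le_maxSize (𝒦 : SubFamily k δ) (b : Fin 𝒦.t) :
    (𝒦.L b).size ≤ 𝒦.maxSize :=
  Finset.le_sup (f := fun b => (𝒦.L b).size) (Finset.mem_univ b)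

/-- The differentials of the induced free resolution. -/
def SubFamily.symDiff (𝒦 : SubFamily k δ) (e : D) (i : ℕ) :
    (Gen δ (𝒦.syz (i + 1)).L e →₀ MvPolynomial (MonOf δ e) k) →ₗ[MvPolynomial (MonOf δ e) k]
      (Gen δ (𝒦.syz i).L e →₀ MvPolynomial (MonOf δ e) k) :=
  symGenMap (𝒦.syz i).gens e

theorem SubFamily.range_symDiff (𝒦 : SubFamily k δ) (e : D) (i : ℕ) :
    Set.range (𝒦.symDiff e i) = (𝒦.syz i).sym e :=
  (𝒦.syz i).generates_gens.range_symGenMap e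

theorem SubFamily.exact_symDiff [CharZero k] (𝒦 : SubFamily k δ) (e : D) (i : ℕ) :
    Function.Exact (𝒦.symDiff e (i + 1)) (𝒦.symDiff e i) := by
  intro y
  rw [𝒦.range_symDiff e (i + 1)]
  exact symGenMap_eq_zero_iff (𝒦.syz i).gens e y

end Syzygies

/-! ### Homogeneous generators -/

section Generators

universe u v

variable {k : Type u} [Field k] {B : Type v} [CommRing B] [Algebra k B] {ℓ : ℕ}
  (𝓑 : (Fin ℓ → ℕ) → Submodule k B)

theorem exists_homogeneous_generators
    (hfin : ∀ d : Fin ℓ → ℕ, ∑ a, d a = 1 → FiniteDimensional k (𝓑 d))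
    (hgen : Algebra.adjoin k {b : B | ∃ d : Fin ℓ → ℕ, ∑ a, d a = 1 ∧ b ∈ 𝓑 d} = ⊤) :
    ∃ (N : ℕ) (x : Fin N → B) (c : Fin N → Fin ℓ → ℕ), (∀ i, x i ∈ 𝓑 (c i)) ∧
      Algebra.adjoin k (Set.range x) = ⊤ := by
  classical
  -- Vectors with coordinate sum `1` lie in the box from `0` to `1`.
  have hdeg : {d : Fin ℓ → ℕ | ∑ a, d a = 1}.Finite :=
    (Set.finite_Icc (0 : Fin ℓ → ℕ) 1).subset fun d hd => ⟨zero_le, fun a =>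
      (Finset.single_le_sum (fun _ _ => Nat.zero_le _) (Finset.mem_univ a)).trans_eq hd⟩
  have hspan : ∀ d : Fin ℓ → ℕ, ∑ a, d a = 1 → ∃ s : Finset B, Submodule.span k s = 𝓑 d :=
    fun d hd => (Submodule.fg_iff_finiteDimensional _).2 (hfin d hd)
  choose! s hs using hspan
  let G : Finset (Σ _ : Fin ℓ → ℕ, B) := hdeg.toFinset.sigma fun d => s d
  let e := G.equivFin.symm
  refine ⟨G.card, fun i => (e i).1.2, fun i => (e i).1.1, fun i => ?_, ?_⟩
  · have h := Finset.mem_sigma.1 (e i).2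
    rw [← hs _ (hdeg.mem_toFinset.1 h.1)]
    exact Submodule.subset_span h.2
  · rw [eq_top_iff, ← hgen, Algebra.adjoin_le_iff]
    rintro b ⟨d, hd, hb⟩
    rw [← hs d hd] at hb
    refine (Submodule.span_le (p := Subalgebra.toSubmodule
      (Algebra.adjoin k (Set.range fun i => (e i).1.2)))).2 (fun y hy => ?_) hb
    refine Algebra.subset_adjoin ⟨e.symm ⟨⟨d, y⟩, ?_⟩, ?_⟩
    · exact Finset.mem_sigma.2 ⟨hdeg.mem_toFinset.2 hd, hy⟩
    · simp

/-- The degree of a monomial in variables of degrees `c i`. -/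
def degMap {N : ℕ} {D : Type*} [AddCommMonoid D] (c : Fin N → D) : (Fin N → ℕ) →+ D where
  toFun α := ∑ i, α i • c i
  map_zero' := by simp
  map_add' α β := by simp [add_smul, Finset.sum_add_distrib]

variable [GradedAlgebra 𝓑] {N : ℕ} {x : Fin N → B} {c : Fin N → Fin ℓ → ℕ}

theorem monEval_mem (hx : ∀ i, x i ∈ 𝓑 (c i)) (α : Fin N → ℕ) :
    monEval x α ∈ 𝓑 (degMap c α) := by
  change ∏ i, x i ^ α i ∈ 𝓑 (∑ i, α i • c i)
  exact SetLike.prod_mem_graded 𝓑 (fun i => α i • c i) (fun i => x i ^ α i) fun i _ =>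
    SetLike.pow_mem_graded (α i) (hx i)

/-- Write an element as a polynomial in the generators and project to degree `e`: monomials of other
degrees disappear. -/
theorem le_span_monEval (hx : ∀ i, x i ∈ 𝓑 (c i)) (hadj : Algebra.adjoin k (Set.range x) = ⊤)
    (e : Fin ℓ → ℕ) :
    𝓑 e ≤ Submodule.span k (Set.range fun α : MonOf (degMap c) e => monEval x α.1) := by
  classical
  intro b hb
  have hb' : b ∈ Algebra.adjoin k (Set.range x) := by
    rw [hadj]
    trivial
  rw [Algebra.adjoin_range_eq_range_aeval] at hb'
  obtain ⟨P, rfl⟩ := hb'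
  change MvPolynomial.aeval x P ∈ 𝓑 e at hb
  change MvPolynomial.aeval x P ∈ _
  have h1 : GradedAlgebra.proj 𝓑 e (MvPolynomial.aeval x P) = MvPolynomial.aeval x P :=
    DirectSum.decompose_of_mem_same 𝓑 hb
  rw [← h1, MvPolynomial.aeval_def, MvPolynomial.eval₂_eq', map_sum]
  refine sum_mem fun s _ => ?_
  rw [← Algebra.smul_def, map_smul]
  refine Submodule.smul_mem _ _ ?_
  have h2 : monEval x s ∈ 𝓑 (degMap c s) := monEval_mem 𝓑 hx s
  change GradedAlgebra.proj 𝓑 e (monEval x s) ∈ _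
  rw [GradedAlgebra.proj_apply]
  by_cases hs : degMap c s = e
  · rw [DirectSum.decompose_of_mem_same 𝓑 (hs ▸ h2)]
    exact Submodule.subset_span ⟨⟨s, hs⟩, rfl⟩
  · rw [DirectSum.decompose_of_mem_ne 𝓑 h2 hs]
    exact zero_mem _

end Generators

/-! ### The resolution of the secant algebra -/

section Main

universe u v

variable {k : Type u} [Field k] {B : Type v} [CommRing B] [Algebra k B] {ℓ : ℕ}
  (𝓑 : (Fin ℓ → ℕ) → Submodule k B) {N : ℕ} {D : Type*} [AddCommMonoid D]

theorem mem_augIdeal_of_mem_symGrading {V : Type*} [AddCommGroup V] [Module k V] {n : ℕ}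
    (hn : 0 < n) (r : SymmetricAlgebra k V) (hr : r ∈ symGrading k V n) : r ∈ augIdeal k V := by
  obtain ⟨n, rfl⟩ : ∃ m, n = m + 1 := ⟨n - 1, by omega⟩
  rw [symGrading, pow_succ] at hr
  induction hr using Submodule.mul_induction_on' with
  | mem_mul_mem a _ b hb =>
    obtain ⟨v, rfl⟩ := hb
    refine Ideal.mul_mem_left _ _ ?_
    rw [augIdeal, RingHom.mem_ker, SymmetricAlgebra.algebraMapInv_ι]
  | add a _ b _ ha hb => exact add_mem ha hb

theorem aeval_ι_mem_symGrading {V T : Type*} [AddCommGroup V] [Module k V] (f : T → V) (n : ℕ)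
    (a : MvPolynomial T k) (ha : a ∈ MvPolynomial.homogeneousSubmodule T k n) :
    MvPolynomial.aeval (fun t => SymmetricAlgebra.ι k V (f t)) a ∈ symGrading k V n := by
  have hmon : ∀ s : T →₀ ℕ, MvPolynomial.aeval (fun t => SymmetricAlgebra.ι k V (f t))
      (MvPolynomial.monomial s (1 : k)) ∈ symGrading k V s.degree := by
    intro s
    induction s using Finsupp.induction_linear with
    | zero => simp [symGrading]
    | add s t hs ht =>
      rw [← one_mul (1 : k), ← MvPolynomial.monomial_mul, map_mul, map_add]
      exact symGrading_mul _ _ _ hs _ ht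
    | single i m =>
      rw [MvPolynomial.aeval_monomial, map_one, one_mul, Finsupp.degree_single]
      refine (Finsupp.prod_single_index (h := fun i m => SymmetricAlgebra.ι k V (f i) ^ m)
        (pow_zero _)).symm ▸ ?_
      exact Submodule.pow_mem_pow _ (LinearMap.mem_range_self _ (f i)) m
  rw [a.as_sum, map_sum]
  refine sum_mem fun s hs => ?_
  rw [← mul_one (a.coeff s), ← smul_eq_mul, ← MvPolynomial.smul_monomial, map_smul]
  have h1 : Finsupp.weight 1 s = n := ha (MvPolynomial.mem_support_iff.1 hs)
  have h2 := DFunLike.congr_fun (Finsupp.degree_eq_weight_one (σ := T) (R := ℕ)) s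
  have := h2.trans h1
  exact Submodule.smul_mem _ _ (this ▸ hmon s)

/-- A Tor bound for the secant algebras from a description of the secant ideals by power sums. -/
theorem torSecConcentrated_maxSize [CharZero k] {δ : (Fin N → ℕ) →+ (Fin ℓ → ℕ)} {x : Fin N → B}
    (hmem : ∀ α, monEval x α ∈ 𝓑 (δ α)) (e : Fin ℓ → ℕ)
    (hspan : 𝓑 e ≤ Submodule.span k (Set.range fun α : MonOf δ e => monEval x α.1))
    {σ : Type*} [Fintype σ] {E : Type*} [CommRing E] [Algebra k E] (ι : σ → B →ₐ[k] E) (r : ℕ)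
    (hr : ∀ y, y ∈ secantIdeal 𝓑 e r ↔ powerMap ι (𝓑 e).subtype y = 0) (i : ℕ) :
    TorSecConcentrated 𝓑 e i r ((baseFamily δ x ι).syz i).maxSize := by
  intro P j hj
  let f : MonOf δ e → 𝓑 e := fun α => ⟨monEval x α.1, by
    have h := hmem α.1
    rwa [α.2] at h⟩
  let p : MvPolynomial (MonOf δ e) k →ₐ[k] SymmetricAlgebra k (𝓑 e) :=
    MvPolynomial.aeval fun α => SymmetricAlgebra.ι k (𝓑 e) (f α)
  have hf : Function.Surjective (Finsupp.linearCombination k f) := by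
    rw [← LinearMap.range_eq_top, Finsupp.range_linearCombination, eq_top_iff]
    rintro ⟨b, hb⟩ -
    have h1 := hspan hb
    have h2 : Set.range (fun α : MonOf δ e => monEval x α.1) =
        (𝓑 e).subtype '' Set.range f := by
      rw [← Set.range_comp]
      rfl
    rw [h2, Submodule.span_image] at h1
    obtain ⟨b', hb', h3⟩ := h1
    rwa [← show b' = ⟨b, hb⟩ from Subtype.ext h3]
  -- A linear section of the surjection onto `𝓑 e` induces the ring section `s` of `p`.
  obtain ⟨g, hg⟩ := (Finsupp.linearCombination k f).exists_rightInverse_of_surjective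
    (LinearMap.range_eq_top.2 hf)
  let s : SymmetricAlgebra k (𝓑 e) →ₐ[k] MvPolynomial (MonOf δ e) k :=
    SymmetricAlgebra.lift (Finsupp.linearCombination k MvPolynomial.X ∘ₗ g)
  have hps : ∀ y, p (s y) = y := by
    have h1 : ∀ a, p (Finsupp.linearCombination k MvPolynomial.X a) =
        SymmetricAlgebra.ι k (𝓑 e) (Finsupp.linearCombination k f a) := by
      intro a
      simp [Finsupp.linearCombination_apply, Finsupp.sum, p]
    have h2 : p.comp s = AlgHom.id k _ := by
      ext v
      have h3 := LinearMap.congr_fun hg v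
      simp only [LinearMap.comp_apply, LinearMap.id_apply] at h3
      simp [s, h1, h3]
    exact fun y => AlgHom.congr_fun h2 y
  let η₀ : (Gen δ (baseObj (Fin ℓ → ℕ)) e →₀ MvPolynomial (MonOf δ e) k) →ₛₗ[p.toRingHom]
      SymmetricAlgebra k (𝓑 e) := semiComb p.toRingHom fun _ => 1
  have hη₀ : ∀ γ a, η₀ (Finsupp.single γ a) = p a := by
    intro γ a
    simp only [η₀, semiComb_single]
    exact mul_one _
  let η : (Gen δ (baseObj (Fin ℓ → ℕ)) e →₀ MvPolynomial (MonOf δ e) k) →ₛₗ[p.toRingHom]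
      Sec 𝓑 e r := (Submodule.mkQ (secantIdeal 𝓑 e r)).comp η₀
  have hη : ∀ y, η y = Ideal.Quotient.mk (secantIdeal 𝓑 e r) (η₀ y) := fun y => rfl
  -- The power sum map on the polynomial ring factors through `p`, so the kernel of `augMap` is the
  -- preimage of the secant ideal.
  have haug : ∀ y, augMap δ x ι e y = powerMap ι (𝓑 e).subtype (η₀ y) := by
    have h1 : monPower δ x ι e = (powerMap ι (𝓑 e).subtype).comp p := by
      ext α : 1
      simp [monPower, p, powerMap_ι, f]
    intro y
    induction y using Finsupp.induction_linear with
    | zero => rw [map_zero, map_zero, map_zero]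
    | add a b ha hb => rw [map_add, map_add, map_add, ha, hb]
    | single γ a =>
      rw [hη₀, augMap, Finsupp.lsum_single, h1]
      rfl
  have hη_mem : ∀ γ, η (Finsupp.single γ 1) ∈ quotGrading (secantIdeal 𝓑 e r) 0 := by
    intro γ
    rw [hη, hη₀, map_one]
    exact ⟨1, by simp [symGrading], rfl⟩
  have hη_surj : Function.Surjective η := by
    intro y
    obtain ⟨y, rfl⟩ := Ideal.Quotient.mk_surjective y
    -- The source of `baseFamily` has no positions, so its free module has rank one, with basis the
    -- empty tuple.
    exact ⟨Finsupp.single ⟨0, fun i => i.elim0⟩ (s y), by rw [hη, hη₀, hps]⟩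
  have hη_zero : ∀ y, η y = 0 ↔ y ∈ (baseFamily δ x ι).sym e := by
    intro y
    rw [← augMap_eq_zero_iff, haug, ← hr, hη, Ideal.Quotient.eq_zero_iff_mem]
  let 𝒦 := baseFamily δ x ι
  refine P.torDeg_eq_bot (isGraded_quot _ (isHomog_secantIdeal 𝓑 e r)) (augIdeal k (𝓑 e))
    (fun y hy => ⟨_, fun n => (coact k (𝓑 e) y).coeff n,
      fun n => ⟨coeff_coact_mem y n, isHomog_augIdeal y hy n⟩, sum_coeff_coact y⟩)
    (fun n hn y hy => mem_augIdeal_of_mem_symGrading hn y hy) p.toRingHom s.toRingHom hps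
    (fun n => (MvPolynomial.homogeneousSubmodule (MonOf δ e) k n).toAddSubgroup)
    (fun n a ha => aeval_ι_mem_symGrading f n a ha) ?_
    (Γ := fun i => Gen δ (𝒦.syz i).L e) (fun i γ => ((𝒦.syz i).L γ.1).size) (𝒦.symDiff e) η
    (fun i γ => symGenMap_single_mem (𝒦.syz i).gens e γ) hη_mem hη_surj ?_ (𝒦.exact_symDiff e)
    (fun γ => (𝒦.syz i).size_le_maxSize γ.1) hj
  · rw [eq_top_iff]
    rintro a -
    rw [← MvPolynomial.sum_homogeneousComponent a]
    exact sum_mem fun n _ => AddSubgroup.mem_iSup_of_mem n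
      (MvPolynomial.homogeneousComponent_mem n a)
  · intro y
    rw [𝒦.range_symDiff e 0]
    exact hη_zero y

end Main

end SecantSyzygies

end

open SecantSyzygies in
theorem mainTheorem5 {k : Type*} [Field k] [CharZero k] {B : Type*} [CommRing B] [Algebra k B]
    {ℓ : ℕ} (𝓑 : (Fin ℓ → ℕ) → Submodule k B) [GradedAlgebra 𝓑]
    (hfin : ∀ d : Fin ℓ → ℕ, ∑ a, d a = 1 → FiniteDimensional k (𝓑 d))
    (hgen : Algebra.adjoin k {b : B | ∃ d : Fin ℓ → ℕ, ∑ a, d a = 1 ∧ b ∈ 𝓑 d} = ⊤) :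
    ∃ C : ℕ → ℕ → ℕ, ∀ i r : ℕ, 1 ≤ r → ∀ d : Fin ℓ → ℕ,
      TorSecConcentrated 𝓑 d i r (C i r) := by
  obtain ⟨N, x, c, hx, hadj⟩ := exists_homogeneous_generators 𝓑 hfin hgen
  have h : ∀ i r : ℕ, ∃ C, ∀ d, TorSecConcentrated 𝓑 d i (r + 1) C := by
    intro i r
    obtain ⟨σ, _, E, _, _, ι, hr⟩ := exists_secantIdeal_eq_ker 𝓑 r
    -- The bound is the `maxSize` of the `i`-th syzygy family, built from `x`, `c` and `ι` before
    -- `d` is introduced.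
    exact ⟨_, fun d => torSecConcentrated_maxSize 𝓑 (monEval_mem 𝓑 hx) d
      (le_span_monEval 𝓑 hx hadj d) ι (r + 1) (hr d) i⟩
  choose C hC using h
  -- `C i r` bounds the case `r + 1`, whence the shift.
  refine ⟨fun i r => C i (r - 1), fun i r hr d => ?_⟩
  obtain ⟨r, rfl⟩ : ∃ m, r = m + 1 := ⟨r - 1, by omega⟩
  exact hC i r d
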